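/- Let $G$ be a finite group and let $T$ be a $G$-Tambara functor, given by commutative rings $T(G/H)$ for $H\le G$ with restrictions, transfers, norms and conjugations satisfying functoriality (including that $r^H_H,t^H_H,N^H_H$ and $c_{h,H}$, $h\in H$, are identities), conjugacy compatibility, the additive and multiplicative double coset formulas, Frobenius reciprocity, and Tambara reciprocity for sums and for transfers. A Tambara ideal $I\trianglelefteq T$ is a family of ideals $I(G/H)\subseteq T(G/H)$ closed under restrictions, transfers, norms and conjugations. The sum and the intersection of two Tambara ideals are formed levelwise; the product $IJ$ is the Tambara ideal generated by the levelwise products $I(G/H)J(G/H)$; $\langle x\rangle$ denotes the Tambara ideal generated by $x$. The radical $\sqrt I$ is given by $(\sqrt I)(G/H)=\{x\in T(G/H) : \langle x\rangle^n\subseteq I\text{ for some }n\ge 1\}$, and $I$ is radical if $I=\sqrt I$. Let $\mathrm{RadId}_G(T)$ be the set of radical Tambara ideals of $T$, ordered by inclusion; it is a complete lattice. A Tambara ideal $P$ is prime if $1\notin P(G/G)$ and, for all Tambara ideals $I,J$, $IJ\subseteq P$ implies $I\subseteq P$ or $J\subseteq P$. Let $\mathrm{Spec}_{\mathrm{Nak}}(T)$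 be the set of prime Tambara ideals, with the topology in which the sets $\{P : x\in P(G/H)\}$, for $H\le G$ and $x\in T(G/H)$, form a subbasis for the closed sets. Let $T_{\mathrm{red}}=T/\sqrt 0$ be the levelwise quotient. Then the following are equivalent: (i) $\mathrm{Spec}_{\mathrm{Nak}}(T)$ is disconnected, i.e. it is the union of two disjoint nonempty open subsets; (ii) the lattice $\mathrm{RadId}_G(T)$ has a complemented element different from its bottom element and its top element; (iii) there are radical Tambara ideals $I,J\trianglelefteq T_{\mathrm{red}}$ with $I+J=T_{\mathrm{red}}$, $I\cap J=0$, $I\neq 0$ and $J\ne 0$; (iv) there are nonzero $G$-Tambara functors $T_1,T_2$ and an isomorphism of $G$-Tambara functors $T_{\mathrm{red}}\cong T_1\times T_2$ (levelwise product). -/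

import Mathlib

universe u v

namespace Tamb

section Groups

variable {G : Type v} [Group G]

/-- The conjugate subgroup `g H g⁻¹`. -/
def conj (g : G) (H : Subgroup G) : Subgroup G :=
  H.map (MulAut.conj g).toMonoidHom

theorem conj_inv {g : G} {H K : Subgroup G} (e : K = conj g H) : H = conj g⁻¹ K := by
  subst e
  ext x
  simp [conj, Subgroup.mem_map, mul_assoc]

theorem conj_of_eq_one {k : G} (hk : k = 1) (H : Subgroup G) : H = conj k H := by
  subst hk
  ext x
  simp [conj, Subgroup.mem_map]

/-- The set of left cosets `H / K` for `K ≤ H ≤ G`, a left `H`-set. -/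
abbrev Cosets (K H : Subgroup G) : Type v := ↥H ⧸ K.subgroupOf H

/-- The set of double cosets `L \ K / H` for subgroups `H, L ≤ K`. -/
def DoubleCosets (L K H : Subgroup G) : Type v :=
  DoubleCoset.Quotient (L.subgroupOf K : Set ↥K) (H.subgroupOf K : Set ↥K)

noncomputable instance [Finite G] (L K H : Subgroup G) : Fintype (DoubleCosets L K H) :=
  haveI : Finite (DoubleCosets L K H) := inferInstanceAs (Finite (_root_.Quotient _))
  Fintype.ofFinite _

instance (L K H : Subgroup G) : Inhabited (DoubleCosets L K H) :=
  ⟨DoubleCoset.mk (L.subgroupOf K) (H.subgroupOf K) 1⟩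

/-- A chosen representative `γ ∈ K` of a double coset `LγH ∈ L \ K / H`. -/
noncomputable def DoubleCosets.rep {L K H : Subgroup G} (q : DoubleCosets L K H) : ↥K :=
  _root_.Quotient.out q

/-- The `H`-set `Map(H/K, {a, b})`; the value `true` stands for `a` and `false` for `b`.
Equivalently, the sections of the `H`-map `H/K ⊔ H/K → H/K`. -/
def Colouring (K H : Subgroup G) : Type v := Cosets K H → Bool

/-- `H` acts on `Map(H/K, {a, b})` by `(h • F) x = F (h⁻¹ • x)`. -/
instance (K H : Subgroup G) : MulAction ↥H (Colouring K H) where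
  smul h F := fun x => F (h⁻¹ • x)
  one_smul F := by
    funext x
    change F ((1 : ↥H)⁻¹ • x) = F x
    simp
  mul_smul h k F := by
    funext x
    change F ((h * k)⁻¹ • x) = F (k⁻¹ • h⁻¹ • x)
    rw [mul_inv_rev, mul_smul]

/-- The projection `H/L → H/K` for `L ≤ K ≤ H`. -/
def cosetProj {L K : Subgroup G} (h : L ≤ K) (H : Subgroup G) : Cosets L H → Cosets K H :=
  Subgroup.quotientMapOfLE (Subgroup.comap_mono h)

theorem cosetProj_smul {L K : Subgroup G} (h : L ≤ K) (H : Subgroup G) (g : ↥H)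
    (x : Cosets L H) : cosetProj h H (g • x) = g • cosetProj h H x := by
  induction x using QuotientGroup.induction_on with
  | H z => rfl

/-- The `H`-set of sections (not necessarily equivariant) of the projection `H/L → H/K`. -/
def CosetSection {L K : Subgroup G} (h : L ≤ K) (H : Subgroup G) : Type v :=
  {s : Cosets K H → Cosets L H // ∀ x, cosetProj h H (s x) = x}

/-- `H` acts on sections by `(h • s) x = h • s (h⁻¹ • x)`. -/
instance {L K : Subgroup G} (h : L ≤ K) (H : Subgroup G) : MulAction ↥H (CosetSection h H) where
  smul g s := ⟨fun x => g • s.1 (g⁻¹ • x), fun x => by rw [cosetProj_smul, s.2, smul_inv_smul]⟩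
  one_smul s := by
    apply Subtype.ext
    funext x
    change (1 : ↥H) • s.1 ((1 : ↥H)⁻¹ • x) = s.1 x
    simp
  mul_smul g k s := by
    apply Subtype.ext
    funext x
    change (g * k) • s.1 ((g * k)⁻¹ • x) = g • k • s.1 (k⁻¹ • g⁻¹ • x)
    rw [mul_inv_rev, mul_smul, mul_smul]

/-- The set of `H`-orbits of an `H`-set. -/
def Orbits (H : Subgroup G) (X : Type v) [MulAction ↥H X] : Type v :=
  MulAction.orbitRel.Quotient ↥H X

/-- A chosen representative of an orbit. -/
noncomputable def Orbits.rep {H : Subgroup G} {X : Type v} [MulAction ↥H X]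
    (o : Orbits H X) : X :=
  _root_.Quotient.out o

noncomputable instance [Finite G] (K H : Subgroup G) : Fintype (Orbits H (Colouring K H)) :=
  haveI : Finite (Colouring K H) := inferInstanceAs (Finite (Cosets K H → Bool))
  haveI : Finite (Orbits H (Colouring K H)) := inferInstanceAs (Finite (_root_.Quotient _))
  Fintype.ofFinite _

noncomputable instance [Finite G] {L K : Subgroup G} (h : L ≤ K) (H : Subgroup G) :
    Fintype (Orbits H (CosetSection h H)) :=
  haveI : Finite (CosetSection h H) :=
    inferInstanceAs (Finite {s : Cosets K H → Cosets L H // ∀ x, cosetProj h H (s x) = x})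
  haveI : Finite (Orbits H (CosetSection h H)) := inferInstanceAs (Finite (_root_.Quotient _))
  Fintype.ofFinite _

/-- The stabilizer in `H` of a point of an `H`-set, as a subgroup of `G`. -/
def stab (H : Subgroup G) {X : Type v} [MulAction ↥H X] (x : X) : Subgroup G :=
  (MulAction.stabilizer ↥H x).map H.subtype

theorem stab_le (H : Subgroup G) {X : Type v} [MulAction ↥H X] (x : X) : stab H x ≤ H :=
  Subgroup.map_subtype_le _

end Groups

/-- The data underlying a `G`-Tambara functor: a commutative ring `T(G/H)` for every `H ≤ G`,
with restrictions (ring maps), transfers (additive), norms (multiplicative) and conjugations.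
The conjugation `c_{g,H} : T(G/H) → T(G/gHg⁻¹)` is given, to avoid transport along equalities of
subgroups, with an arbitrary name `K` of the subgroup `gHg⁻¹`. -/
structure PreTambara (G : Type v) [Group G] where
  obj : Subgroup G → Type u
  [ring : ∀ H, CommRing (obj H)]
  res : ∀ {K H : Subgroup G}, K ≤ H → obj H →+* obj K
  tr : ∀ {K H : Subgroup G}, K ≤ H → obj K →+ obj H
  nm : ∀ {K H : Subgroup G}, K ≤ H → obj K →* obj H
  c : ∀ (g : G) {H K : Subgroup G}, K = conj g H → obj H →+* obj K

attribute [instance] PreTambara.ring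

section Axioms

variable {G : Type v} [Group G] (T : PreTambara.{u, v} G)

/-- For `x ∈ T(G/H)`, the element `r^{gHg⁻¹}_{L ∩ gHg⁻¹} (c_{g,H} x)` of `T(G/(L ∩ gHg⁻¹))`. -/
def PreTambara.resConj (L : Subgroup G) (g : G) (H : Subgroup G) (x : T.obj H) :
    T.obj (L ⊓ conj g H) :=
  T.res inf_le_right (T.c g rfl x)

/-- `t^L_{L ∩ gHg⁻¹} r^{gHg⁻¹}_{L ∩ gHg⁻¹} c_{g,H} x`. -/
def PreTambara.trConj (L : Subgroup G) (g : G) (H : Subgroup G) (x : T.obj H) : T.obj L :=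
  T.tr inf_le_left (T.resConj L g H x)

/-- `N^L_{L ∩ gHg⁻¹} r^{gHg⁻¹}_{L ∩ gHg⁻¹} c_{g,H} x`. -/
def PreTambara.nmConj (L : Subgroup G) (g : G) (H : Subgroup G) (x : T.obj H) : T.obj L :=
  T.nm inf_le_left (T.resConj L g H x)

open Classical in
/-- The summand of `N^H_K (a + b)` indexed by the orbit of `F ∈ Map(H/K, {a, b})`: with `S` the
stabilizer of `F`, it is the transfer from `S` to `H` of the product, over `[γ] ∈ S \ H / K`, of
`N^S_{S ∩ γKγ⁻¹} r c_γ (F(γK))`. -/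
noncomputable def PreTambara.sumTerm [Finite G] (K H : Subgroup G) (a b : T.obj K)
    (F : Colouring K H) : T.obj H :=
  T.tr (stab_le H F) (∏ q : DoubleCosets (stab H F) H K,
    T.nmConj (stab H F) (q.rep : G) K (if F (QuotientGroup.mk q.rep) = true then a else b))

/-- The summand of `N^H_K (t^K_L b)` indexed by the orbit of a section `s` of `H/L → H/K`: with `S`
the stabilizer of `s`, it is the transfer from `S` to `H` of the product, over
`[γ] ∈ S \ H / K`, of `N^S_{S ∩ δLδ⁻¹} r c_δ b`, where `s(γK) = δL`. (An element of `S` fixes the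
coset `γK` if and only if it fixes `s(γK) = δL`, so that `S ∩ γKγ⁻¹ = S ∩ δLδ⁻¹`.) -/
noncomputable def PreTambara.transferTerm [Finite G] {L K : Subgroup G} (h : L ≤ K)
    (H : Subgroup G) (b : T.obj L) (s : CosetSection h H) : T.obj H :=
  T.tr (stab_le H s) (∏ q : DoubleCosets (stab H s) H K,
    T.nmConj (stab H s) ((s.1 (QuotientGroup.mk q.rep)).out : G) L b)

end Axioms

/-- A `G`-Tambara functor, for a finite group `G`. -/
structure TambaraFunctor (G : Type v) [Group G] [Finite G] extends PreTambara.{u, v} G where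
  /- Functoriality. -/
  res_self : ∀ {H} (x : obj H), res le_rfl x = x
  tr_self : ∀ {H} (x : obj H), tr le_rfl x = x
  nm_self : ∀ {H} (x : obj H), nm le_rfl x = x
  res_res : ∀ {L K H} (h₁ : L ≤ K) (h₂ : K ≤ H) (x : obj H),
    res h₁ (res h₂ x) = res (h₁.trans h₂) x
  tr_tr : ∀ {L K H} (h₁ : L ≤ K) (h₂ : K ≤ H) (x : obj L),
    tr h₂ (tr h₁ x) = tr (h₁.trans h₂) x
  nm_nm : ∀ {L K H} (h₁ : L ≤ K) (h₂ : K ≤ H) (x : obj L),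
    nm h₂ (nm h₁ x) = nm (h₁.trans h₂) x
  c_c : ∀ {g h : G} {H K L} (e₁ : K = conj h H) (e₂ : L = conj g K) (e₃ : L = conj (g * h) H)
    (x : obj H), c g e₂ (c h e₁ x) = c (g * h) e₃ x
  /- Inner conjugations act trivially. -/
  c_of_mem : ∀ {g : G} {H} (_ : g ∈ H) (e : H = conj g H) (x : obj H), c g e x = x
  /- Compatibility with conjugation. -/
  c_res : ∀ {g : G} {K H K' H'} (h : K ≤ H) (h' : K' ≤ H') (eK : K' = conj g K)
    (eH : H' = conj g H) (x : obj H), c g eK (res h x) = res h' (c g eH x)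
  c_nm : ∀ {g : G} {K H K' H'} (h : K ≤ H) (h' : K' ≤ H') (eK : K' = conj g K)
    (eH : H' = conj g H) (x : obj K), c g eH (nm h x) = nm h' (c g eK x)
  c_tr : ∀ {g : G} {K H K' H'} (h : K ≤ H) (h' : K' ≤ H') (eK : K' = conj g K)
    (eH : H' = conj g H) (x : obj K), c g eH (tr h x) = tr h' (c g eK x)
  /- Additive double coset formula. -/
  res_tr : ∀ {L H K} (hL : L ≤ K) (hH : H ≤ K) (x : obj H),
    res hL (tr hH x) = ∑ q : DoubleCosets L K H, toPreTambara.trConj L (q.rep : G) H x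
  /- Multiplicative double coset formula. -/
  res_nm : ∀ {L H K} (hL : L ≤ K) (hH : H ≤ K) (x : obj H),
    res hL (nm hH x) = ∏ q : DoubleCosets L K H, toPreTambara.nmConj L (q.rep : G) H x
  /- Frobenius reciprocity. -/
  frobenius : ∀ {K H} (h : K ≤ H) (x : obj H) (y : obj K), tr h (res h x * y) = x * tr h y
  /- Tambara reciprocity for sums (the empty sum and binary sums). -/
  nm_zero : ∀ {K H} (h : K ≤ H), nm h (0 : obj K) = 0
  nm_add : ∀ {K H} (h : K ≤ H) (a b : obj K),
    nm h (a + b) = ∑ o : Orbits H (Colouring K H), toPreTambara.sumTerm K H a b o.rep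
  /- Tambara reciprocity for transfers. -/
  nm_tr : ∀ {L K H} (h₁ : L ≤ K) (h₂ : K ≤ H) (b : obj L),
    nm h₂ (tr h₁ b) =
      ∑ o : Orbits H (CosetSection h₁ H), toPreTambara.transferTerm h₁ H b o.rep

section Prod

variable {G : Type v} [Group G]

/-- The levelwise product of the underlying data. -/
def PreTambara.prod (S T : PreTambara.{u, v} G) : PreTambara.{u, v} G where
  obj H := S.obj H × T.obj H
  res h := (S.res h).prodMap (T.res h)
  tr h := (S.tr h).prodMap (T.tr h)
  nm h := (S.nm h).prodMap (T.nm h)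
  c g _ _ e := (S.c g e).prodMap (T.c g e)

variable (S T : PreTambara.{u, v} G)

/-- The first projection. -/
def PreTambara.fst (H : Subgroup G) : (S.prod T).obj H →+* S.obj H :=
  RingHom.fst (S.obj H) (T.obj H)

/-- The second projection. -/
def PreTambara.snd (H : Subgroup G) : (S.prod T).obj H →+* T.obj H :=
  RingHom.snd (S.obj H) (T.obj H)

theorem PreTambara.prod_ext {H : Subgroup G} {x y : (S.prod T).obj H}
    (h₁ : S.fst T H x = S.fst T H y) (h₂ : S.snd T H x = S.snd T H y) : x = y :=
  Prod.ext h₁ h₂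

theorem PreTambara.fst_tr {K H : Subgroup G} (h : K ≤ H) (x : (S.prod T).obj K) :
    S.fst T H ((S.prod T).tr h x) = S.tr h (S.fst T K x) := rfl

theorem PreTambara.fst_nm {K H : Subgroup G} (h : K ≤ H) (x : (S.prod T).obj K) :
    S.fst T H ((S.prod T).nm h x) = S.nm h (S.fst T K x) := rfl

theorem PreTambara.fst_res {K H : Subgroup G} (h : K ≤ H) (x : (S.prod T).obj H) :
    S.fst T K ((S.prod T).res h x) = S.res h (S.fst T H x) := rfl

theorem PreTambara.fst_trConj (L : Subgroup G) (g : G) (H : Subgroup G)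
    (x : (S.prod T).obj H) :
    S.fst T L ((S.prod T).trConj L g H x) = S.trConj L g H (S.fst T H x) := rfl

theorem PreTambara.fst_nmConj (L : Subgroup G) (g : G) (H : Subgroup G)
    (x : (S.prod T).obj H) :
    S.fst T L ((S.prod T).nmConj L g H x) = S.nmConj L g H (S.fst T H x) := rfl

theorem PreTambara.snd_tr {K H : Subgroup G} (h : K ≤ H) (x : (S.prod T).obj K) :
    S.snd T H ((S.prod T).tr h x) = T.tr h (S.snd T K x) := rfl

theorem PreTambara.snd_nm {K H : Subgroup G} (h : K ≤ H) (x : (S.prod T).obj K) :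
    S.snd T H ((S.prod T).nm h x) = T.nm h (S.snd T K x) := rfl

theorem PreTambara.snd_res {K H : Subgroup G} (h : K ≤ H) (x : (S.prod T).obj H) :
    S.snd T K ((S.prod T).res h x) = T.res h (S.snd T H x) := rfl

theorem PreTambara.snd_trConj (L : Subgroup G) (g : G) (H : Subgroup G)
    (x : (S.prod T).obj H) :
    S.snd T L ((S.prod T).trConj L g H x) = T.trConj L g H (S.snd T H x) := rfl

theorem PreTambara.snd_nmConj (L : Subgroup G) (g : G) (H : Subgroup G)
    (x : (S.prod T).obj H) :
    S.snd T L ((S.prod T).nmConj L g H x) = T.nmConj L g H (S.snd T H x) := rfl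

variable [Finite G]

theorem PreTambara.fst_sumTerm (K H : Subgroup G) (a b : (S.prod T).obj K)
    (F : Colouring K H) : S.fst T H ((S.prod T).sumTerm K H a b F) =
      S.sumTerm K H (S.fst T K a) (S.fst T K b) F := by
  rw [PreTambara.sumTerm, PreTambara.sumTerm, PreTambara.fst_tr, map_prod (S.fst T _)]
  simp only [PreTambara.fst_nmConj, apply_ite (S.fst T K)]

theorem PreTambara.fst_transferTerm {L K : Subgroup G} (h : L ≤ K) (H : Subgroup G)
    (b : (S.prod T).obj L) (s : CosetSection h H) : S.fst T H ((S.prod T).transferTerm h H b s) =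
      S.transferTerm h H (S.fst T L b) s := by
  rw [PreTambara.transferTerm, PreTambara.transferTerm, PreTambara.fst_tr, map_prod (S.fst T _)]
  simp only [PreTambara.fst_nmConj]

theorem PreTambara.snd_sumTerm (K H : Subgroup G) (a b : (S.prod T).obj K)
    (F : Colouring K H) : S.snd T H ((S.prod T).sumTerm K H a b F) =
      T.sumTerm K H (S.snd T K a) (S.snd T K b) F := by
  rw [PreTambara.sumTerm, PreTambara.sumTerm, PreTambara.snd_tr, map_prod (S.snd T _)]
  simp only [PreTambara.snd_nmConj, apply_ite (S.snd T K)]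

theorem PreTambara.snd_transferTerm {L K : Subgroup G} (h : L ≤ K) (H : Subgroup G)
    (b : (S.prod T).obj L) (s : CosetSection h H) : S.snd T H ((S.prod T).transferTerm h H b s) =
      T.transferTerm h H (S.snd T L b) s := by
  rw [PreTambara.transferTerm, PreTambara.transferTerm, PreTambara.snd_tr, map_prod (S.snd T _)]
  simp only [PreTambara.snd_nmConj]

/-- The product of two `G`-Tambara functors, computed levelwise. -/
def TambaraFunctor.prod (S T : TambaraFunctor.{u, v} G) : TambaraFunctor.{u, v} G where
  toPreTambara := S.toPreTambara.prod T.toPreTambara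
  res_self x := Prod.ext (S.res_self _) (T.res_self _)
  tr_self x := Prod.ext (S.tr_self _) (T.tr_self _)
  nm_self x := Prod.ext (S.nm_self _) (T.nm_self _)
  res_res h₁ h₂ x := Prod.ext (S.res_res h₁ h₂ _) (T.res_res h₁ h₂ _)
  tr_tr h₁ h₂ x := Prod.ext (S.tr_tr h₁ h₂ _) (T.tr_tr h₁ h₂ _)
  nm_nm h₁ h₂ x := Prod.ext (S.nm_nm h₁ h₂ _) (T.nm_nm h₁ h₂ _)
  c_c e₁ e₂ e₃ x := Prod.ext (S.c_c e₁ e₂ e₃ _) (T.c_c e₁ e₂ e₃ _)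
  c_of_mem h e x := Prod.ext (S.c_of_mem h e _) (T.c_of_mem h e _)
  c_res h h' e e' x := Prod.ext (S.c_res h h' e e' _) (T.c_res h h' e e' _)
  c_nm h h' e e' x := Prod.ext (S.c_nm h h' e e' _) (T.c_nm h h' e e' _)
  c_tr h h' e e' x := Prod.ext (S.c_tr h h' e e' _) (T.c_tr h h' e e' _)
  res_tr hL hH x := by
    apply PreTambara.prod_ext
    · rw [PreTambara.fst_res, PreTambara.fst_tr, S.res_tr, map_sum (PreTambara.fst _ _ _)]
      simp only [PreTambara.fst_trConj]
    · rw [PreTambara.snd_res, PreTambara.snd_tr, T.res_tr, map_sum (PreTambara.snd _ _ _)]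
      simp only [PreTambara.snd_trConj]
  res_nm hL hH x := by
    apply PreTambara.prod_ext
    · rw [PreTambara.fst_res, PreTambara.fst_nm, S.res_nm, map_prod (PreTambara.fst _ _ _)]
      simp only [PreTambara.fst_nmConj]
    · rw [PreTambara.snd_res, PreTambara.snd_nm, T.res_nm, map_prod (PreTambara.snd _ _ _)]
      simp only [PreTambara.snd_nmConj]
  frobenius h x y := Prod.ext (S.frobenius h _ _) (T.frobenius h _ _)
  nm_zero h := Prod.ext (S.nm_zero h) (T.nm_zero h)
  nm_add h a b := by
    apply PreTambara.prod_ext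
    · rw [PreTambara.fst_nm, map_add, S.nm_add, map_sum (PreTambara.fst _ _ _)]
      simp only [PreTambara.fst_sumTerm]
    · rw [PreTambara.snd_nm, map_add, T.nm_add, map_sum (PreTambara.snd _ _ _)]
      simp only [PreTambara.snd_sumTerm]
  nm_tr h₁ h₂ b := by
    apply PreTambara.prod_ext
    · rw [PreTambara.fst_nm, PreTambara.fst_tr, S.nm_tr, map_sum (PreTambara.fst _ _ _)]
      simp only [PreTambara.fst_transferTerm]
    · rw [PreTambara.snd_nm, PreTambara.snd_tr, T.nm_tr, map_sum (PreTambara.snd _ _ _)]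
      simp only [PreTambara.snd_transferTerm]

end Prod

variable {G : Type v} [Group G] [Finite G]

theorem TambaraFunctor.c_eq_one (T : TambaraFunctor.{u, v} G) {k : G} (hk : k = 1)
    {H : Subgroup G} (e : H = conj k H) (x : T.obj H) : T.c k e x = x :=
  T.c_of_mem (hk ▸ H.one_mem) e x

theorem TambaraFunctor.c_inv_right (T : TambaraFunctor.{u, v} G) (g : G) {H K : Subgroup G}
    (e : K = conj g H) (y : T.obj K) : T.c g e (T.c g⁻¹ (conj_inv e) y) = y := by
  rw [T.c_c _ _ (conj_of_eq_one (mul_inv_cancel g) K)]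
  exact T.c_eq_one (mul_inv_cancel g) _ y

theorem TambaraFunctor.c_inv_left (T : TambaraFunctor.{u, v} G) (g : G) {H K : Subgroup G}
    (e : K = conj g H) (x : T.obj H) : T.c g⁻¹ (conj_inv e) (T.c g e x) = x := by
  rw [T.c_c _ _ (conj_of_eq_one (inv_mul_cancel g) H)]
  exact T.c_eq_one (inv_mul_cancel g) _ x

/-- The conjugations are ring isomorphisms. -/
theorem TambaraFunctor.c_bijective (T : TambaraFunctor.{u, v} G) (g : G) {H K : Subgroup G}
    (e : K = conj g H) : Function.Bijective (T.c g e) :=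
  ⟨Function.LeftInverse.injective (T.c_inv_left g e),
    Function.RightInverse.surjective (T.c_inv_right g e)⟩

/-- `T` is nontrivial, that is, `T ≠ 0`: some ring `T(G/H)` is nonzero. -/
def TambaraFunctor.IsNontrivial (T : TambaraFunctor.{u, v} G) : Prop :=
  ∃ H, Nontrivial (T.obj H)

/-- An isomorphism of `G`-Tambara functors. -/
structure TambaraIso (S T : TambaraFunctor.{u, v} G) where
  toEquiv : ∀ H, S.obj H ≃+* T.obj H
  map_res : ∀ {K H} (h : K ≤ H) (x : S.obj H), toEquiv K (S.res h x) = T.res h (toEquiv H x)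
  map_tr : ∀ {K H} (h : K ≤ H) (x : S.obj K), toEquiv H (S.tr h x) = T.tr h (toEquiv K x)
  map_nm : ∀ {K H} (h : K ≤ H) (x : S.obj K), toEquiv H (S.nm h x) = T.nm h (toEquiv K x)
  map_c : ∀ (g : G) {H K} (e : K = conj g H) (x : S.obj H),
    toEquiv K (S.c g e x) = T.c g e (toEquiv H x)

/-- A Tambara ideal of `T`. Closure under `c_g` for all `g` includes `c_{g⁻¹}`, so that
`c_g (I(G/H)) = I(G/gHg⁻¹)`. -/
@[ext]
structure TambaraIdeal (T : TambaraFunctor.{u, v} G) where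
  lvl : ∀ H, Ideal (T.obj H)
  res_mem : ∀ {K H} (h : K ≤ H) {x : T.obj H}, x ∈ lvl H → T.res h x ∈ lvl K
  tr_mem : ∀ {K H} (h : K ≤ H) {x : T.obj K}, x ∈ lvl K → T.tr h x ∈ lvl H
  nm_mem : ∀ {K H} (h : K ≤ H) {x : T.obj K}, x ∈ lvl K → T.nm h x ∈ lvl H
  c_mem : ∀ (g : G) {H K} (e : K = conj g H) {x : T.obj H}, x ∈ lvl H → T.c g e x ∈ lvl K

namespace TambaraIdeal

variable {T : TambaraFunctor.{u, v} G}

/-- `c_g (I(G/H)) = I(G/gHg⁻¹)`. -/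
theorem image_c (I : TambaraIdeal T) (g : G) {H K : Subgroup G} (e : K = conj g H) :
    T.c g e '' (I.lvl H : Set (T.obj H)) = I.lvl K := by
  ext y
  constructor
  · rintro ⟨x, hx, rfl⟩
    exact I.c_mem g e hx
  · intro hy
    exact ⟨T.c g⁻¹ (conj_inv e) y, I.c_mem _ _ hy, T.c_inv_right g e y⟩

/-- Tambara ideals are ordered by levelwise inclusion. -/
instance : PartialOrder (TambaraIdeal T) := PartialOrder.lift lvl fun _ _ h => TambaraIdeal.ext h

theorem le_def {I J : TambaraIdeal T} : I ≤ J ↔ ∀ H, I.lvl H ≤ J.lvl H := Iff.rfl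

/-- Levelwise intersection. -/
instance : InfSet (TambaraIdeal T) where
  sInf S :=
    { lvl := fun H => ⨅ I ∈ S, I.lvl H
      res_mem := fun h x hx => by
        simp only [Submodule.mem_iInf] at hx ⊢
        exact fun I hI => I.res_mem h (hx I hI)
      tr_mem := fun h x hx => by
        simp only [Submodule.mem_iInf] at hx ⊢
        exact fun I hI => I.tr_mem h (hx I hI)
      nm_mem := fun h x hx => by
        simp only [Submodule.mem_iInf] at hx ⊢
        exact fun I hI => I.nm_mem h (hx I hI)
      c_mem := fun g _ _ e x hx => by
        simp only [Submodule.mem_iInf] at hx ⊢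
        exact fun I hI => I.c_mem g e (hx I hI) }

theorem mem_sInf {S : Set (TambaraIdeal T)} {H : Subgroup G} {x : T.obj H} :
    x ∈ (sInf S).lvl H ↔ ∀ I ∈ S, x ∈ I.lvl H := by
  change x ∈ ⨅ I ∈ S, I.lvl H ↔ _
  simp only [Submodule.mem_iInf]

theorem isGLB_sInf (S : Set (TambaraIdeal T)) : IsGLB S (sInf S) :=
  ⟨fun I hI _ _ hx => mem_sInf.1 hx I hI, fun _ hJ _ _ hx => mem_sInf.2 fun _ hI => hJ hI _ hx⟩

/-- The binary levelwise intersection. -/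
def inter (I J : TambaraIdeal T) : TambaraIdeal T where
  lvl H := I.lvl H ⊓ J.lvl H
  res_mem h _ hx := ⟨I.res_mem h hx.1, J.res_mem h hx.2⟩
  tr_mem h _ hx := ⟨I.tr_mem h hx.1, J.tr_mem h hx.2⟩
  nm_mem h _ hx := ⟨I.nm_mem h hx.1, J.nm_mem h hx.2⟩
  c_mem g _ _ e _ hx := ⟨I.c_mem g e hx.1, J.c_mem g e hx.2⟩

theorem nmConj_mem (I : TambaraIdeal T) (L : Subgroup G) (g : G) {H : Subgroup G} {x : T.obj H}
    (hx : x ∈ I.lvl H) : T.nmConj L g H x ∈ I.lvl L :=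
  I.nm_mem _ (I.res_mem _ (I.c_mem _ _ hx))

/-- The levelwise sum `I(G/H) + J(G/H)`. -/
def sum (I J : TambaraIdeal T) : TambaraIdeal T where
  lvl H := I.lvl H ⊔ J.lvl H
  res_mem h x hx := by
    obtain ⟨a, ha, b, hb, rfl⟩ := Submodule.mem_sup.1 hx
    rw [map_add]
    exact Submodule.add_mem_sup (I.res_mem h ha) (J.res_mem h hb)
  tr_mem h x hx := by
    obtain ⟨a, ha, b, hb, rfl⟩ := Submodule.mem_sup.1 hx
    rw [map_add]
    exact Submodule.add_mem_sup (I.tr_mem h ha) (J.tr_mem h hb)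
  nm_mem {K H} h x hx := by
    obtain ⟨a, ha, b, hb, rfl⟩ := Submodule.mem_sup.1 hx
    rw [T.nm_add]
    refine Ideal.sum_mem _ fun o _ => ?_
    rw [PreTambara.sumTerm]
    by_cases hF : o.rep (QuotientGroup.mk
        (default : DoubleCosets (stab H o.rep) H K).rep) = true
    · refine (le_sup_left : I.lvl H ≤ I.lvl H ⊔ J.lvl H) (I.tr_mem _ ?_)
      refine Ideal.mem_of_dvd _ (Finset.dvd_prod_of_mem _ (Finset.mem_univ default)) ?_
      rw [if_pos hF]
      exact I.nmConj_mem _ _ ha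
    · refine (le_sup_right : J.lvl H ≤ I.lvl H ⊔ J.lvl H) (J.tr_mem _ ?_)
      refine Ideal.mem_of_dvd _ (Finset.dvd_prod_of_mem _ (Finset.mem_univ default)) ?_
      rw [if_neg hF]
      exact J.nmConj_mem _ _ hb
  c_mem g _ _ e x hx := by
    obtain ⟨a, ha, b, hb, rfl⟩ := Submodule.mem_sup.1 hx
    rw [map_add]
    exact Submodule.add_mem_sup (I.c_mem g e ha) (J.c_mem g e hb)

/-- The complete lattice of Tambara ideals: `⊓` is the levelwise intersection, `⊔` the levelwise
sum, `⊥` the zero ideal and `⊤` the whole of `T`. -/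
instance : CompleteLattice (TambaraIdeal T) where
  __ := completeLatticeOfInf (TambaraIdeal T) isGLB_sInf
  inf := inter
  le_inf _ _ _ h₁ h₂ := fun H => le_inf (h₁ H) (h₂ H)
  inf_le_left _ _ := fun _ => inf_le_left
  inf_le_right _ _ := fun _ => inf_le_right
  sup := sum
  sup_le _ _ _ h₁ h₂ := fun H => sup_le (h₁ H) (h₂ H)
  le_sup_left _ _ := fun _ => le_sup_left
  le_sup_right _ _ := fun _ => le_sup_right
  bot :=
    { lvl := fun _ => ⊥
      res_mem := fun h x hx => by
        rw [Ideal.mem_bot] at hx ⊢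
        rw [hx, map_zero]
      tr_mem := fun h x hx => by
        rw [Ideal.mem_bot] at hx ⊢
        rw [hx, map_zero]
      nm_mem := fun h x hx => by
        rw [Ideal.mem_bot] at hx ⊢
        rw [hx, T.nm_zero]
      c_mem := fun g _ _ e x hx => by
        rw [Ideal.mem_bot] at hx ⊢
        rw [hx, map_zero] }
  bot_le _ := fun _ => bot_le
  top :=
    { lvl := fun _ => ⊤
      res_mem := fun _ _ _ => trivial
      tr_mem := fun _ _ _ => trivial
      nm_mem := fun _ _ _ => trivial
      c_mem := fun _ _ _ _ _ _ => trivial }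
  le_top _ := fun _ => le_top

/-- The Tambara ideal generated by a subset of each level. -/
def span (X : ∀ H, Set (T.obj H)) : TambaraIdeal T := sInf {I | ∀ H, X H ⊆ I.lvl H}

/-- The Tambara ideal `⟨x⟩` generated by `x ∈ T(G/H)`: the smallest one containing `x`. -/
def principal {H : Subgroup G} (x : T.obj H) : TambaraIdeal T := sInf {I | x ∈ I.lvl H}

/-- The product `I J`: the Tambara ideal generated by the levelwise products. -/
instance : Mul (TambaraIdeal T) where
  mul I J := span fun H => ((I.lvl H * J.lvl H : Ideal (T.obj H)) : Set (T.obj H))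

/-- The `n`-fold product `I ⋯ I`, with `I ^ 0 = T`. -/
def power (I : TambaraIdeal T) : ℕ → TambaraIdeal T
  | 0 => ⊤
  | 1 => I
  | n + 2 => power I (n + 1) * I

theorem subset_span (X : ∀ H, Set (T.obj H)) (H : Subgroup G) : X H ⊆ (span X).lvl H :=
  fun _ hx => mem_sInf.2 fun _ hI => hI H hx

theorem mul_le_iff {I J M : TambaraIdeal T} :
    I * J ≤ M ↔ ∀ H, I.lvl H * J.lvl H ≤ M.lvl H :=
  ⟨fun h H => le_trans (b := (I * J).lvl H)
    (subset_span (fun H => ((I.lvl H * J.lvl H : Ideal (T.obj H)) : Set (T.obj H))) H) (h H), fun h => (isGLB_sInf _).1 h⟩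

theorem mul_mono {I I' J J' : TambaraIdeal T} (h : I ≤ I') (h' : J ≤ J') : I * J ≤ I' * J' :=
  mul_le_iff.2 fun H => le_trans (Ideal.mul_mono (h H) (h' H)) (mul_le_iff.1 le_rfl H)

theorem mul_le_right (I J : TambaraIdeal T) : I * J ≤ J := mul_le_iff.2 fun _ => Ideal.mul_le_right

theorem mul_sup_le (I J M : TambaraIdeal T) : M * (I ⊔ J) ≤ M * I ⊔ M * J :=
  mul_le_iff.2 fun H => by
    change M.lvl H * (I.lvl H ⊔ J.lvl H) ≤ _
    rw [Ideal.mul_sup]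
    exact sup_le_sup (mul_le_iff.1 le_rfl H) (mul_le_iff.1 le_rfl H)

theorem sup_mul_le (I J M : TambaraIdeal T) : (I ⊔ J) * M ≤ I * M ⊔ J * M :=
  mul_le_iff.2 fun H => by
    change (I.lvl H ⊔ J.lvl H) * M.lvl H ≤ _
    rw [Ideal.sup_mul]
    exact sup_le_sup (mul_le_iff.1 le_rfl H) (mul_le_iff.1 le_rfl H)

theorem power_mono {I J : TambaraIdeal T} (h : I ≤ J) : ∀ n, power I n ≤ power J n
  | 0 => le_rfl
  | 1 => h
  | n + 2 => mul_mono (power_mono h (n + 1)) h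

theorem power_mul_le (I : TambaraIdeal T) : ∀ n, power I n * I ≤ power I (n + 1)
  | 0 => mul_le_right _ _
  | _ + 1 => le_rfl

theorem power_sup_le (I J : TambaraIdeal T) :
    ∀ k m n, m + n = k + 1 → power (I ⊔ J) (k + 1) ≤ power I m ⊔ power J n := by
  intro k
  induction k with
  | zero =>
    intro m n h
    rcases m with _ | m
    · exact le_top.trans le_sup_left
    · rcases n with _ | n
      · exact le_top.trans le_sup_right
      · omega
  | succ k ih =>
    intro m n h
    rcases m with _ | m
    · exact le_top.trans le_sup_left
    rcases n with _ | n
    · exact le_top.trans le_sup_right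
    refine le_trans (mul_sup_le _ _ _) (sup_le ?_ ?_)
    · refine le_trans (mul_mono (ih m (n + 1) (by omega)) le_rfl) ?_
      refine le_trans (sup_mul_le _ _ _) (sup_le_sup (power_mul_le _ _) ?_)
      exact mul_le_iff.2 fun _ => Ideal.mul_le_left
    · refine le_trans (mul_mono (ih (m + 1) n (by omega)) le_rfl) ?_
      refine le_trans (sup_mul_le _ _ _) (sup_le_sup ?_ (power_mul_le _ _))
      exact mul_le_iff.2 fun _ => Ideal.mul_le_left

theorem principal_le_iff {H : Subgroup G} {x : T.obj H} {I : TambaraIdeal T} :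
    principal x ≤ I ↔ x ∈ I.lvl H :=
  ⟨fun h => h H (mem_sInf.2 fun _ hI => hI), fun h => (isGLB_sInf _).1 h⟩

theorem mem_principal {H : Subgroup G} (x : T.obj H) : x ∈ (principal x).lvl H :=
  principal_le_iff.1 le_rfl

theorem radical_aux (I : TambaraIdeal T) {H K : Subgroup G} {x : T.obj H} {y : T.obj K}
    (h : y ∈ (principal x).lvl K) (hx : ∃ n, 1 ≤ n ∧ power (principal x) n ≤ I) :
    ∃ n, 1 ≤ n ∧ power (principal y) n ≤ I := by
  obtain ⟨n, hn, hx⟩ := hx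
  exact ⟨n, hn, le_trans (power_mono (principal_le_iff.2 h) n) hx⟩

/-- The radical `√I`, with `(√I)(G/H) = {x | ∃ n ≥ 1, ⟨x⟩ⁿ ⊆ I}`. -/
def radical (I : TambaraIdeal T) : TambaraIdeal T where
  lvl H :=
    { carrier := {x | ∃ n, 1 ≤ n ∧ power (principal x) n ≤ I}
      add_mem' := by
        rintro x y ⟨m, hm, hx⟩ ⟨n, hn, hy⟩
        obtain ⟨k, hk⟩ : ∃ k, m + n = k + 1 := ⟨m + n - 1, by omega⟩
        refine ⟨k + 1, by omega, ?_⟩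
        refine le_trans (power_mono (J := principal x ⊔ principal y) ?_ _)
          (le_trans (power_sup_le _ _ k m n hk) (sup_le hx hy))
        exact principal_le_iff.2
          (Submodule.add_mem_sup (mem_principal x) (mem_principal y))
      zero_mem' := ⟨1, le_rfl, principal_le_iff.2 (Submodule.zero_mem _)⟩
      smul_mem' := fun r _ hx => radical_aux I (Ideal.mul_mem_left _ r (mem_principal _)) hx }
  res_mem h _ hx := radical_aux I ((principal _).res_mem h (mem_principal _)) hx
  tr_mem h _ hx := radical_aux I ((principal _).tr_mem h (mem_principal _)) hx
  nm_mem h _ hx := radical_aux I ((principal _).nm_mem h (mem_principal _)) hx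
  c_mem g _ _ e _ hx := radical_aux I ((principal _).c_mem g e (mem_principal _)) hx

theorem mem_radical {I : TambaraIdeal T} {H : Subgroup G} {x : T.obj H} :
    x ∈ (radical I).lvl H ↔ ∃ n, 1 ≤ n ∧ power (principal x) n ≤ I := Iff.rfl

/-- `I` is radical if `I = √I`. -/
def IsRadical (I : TambaraIdeal T) : Prop := I = radical I

theorem le_radical (I : TambaraIdeal T) : I ≤ radical I :=
  fun _ _ hx => ⟨1, le_rfl, principal_le_iff.2 hx⟩

theorem isRadical_sInf (S : Set (TambaraIdeal T)) (hS : ∀ I ∈ S, I.IsRadical) :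
    (sInf S).IsRadical := by
  refine le_antisymm (le_radical _) fun H x hx => mem_sInf.2 fun I hI => ?_
  obtain ⟨n, hn, hx⟩ := hx
  rw [hS I hI]
  exact ⟨n, hn, hx.trans ((isGLB_sInf S).1 hI)⟩

/-- `I` is proper if `1 ∉ I(G/G)`. -/
def IsProper (I : TambaraIdeal T) : Prop := (1 : T.obj ⊤) ∉ I.lvl ⊤

/-- Nakaoka prime ideals. -/
def IsPrime (P : TambaraIdeal T) : Prop :=
  P.IsProper ∧ ∀ I J : TambaraIdeal T, I * J ≤ P → I ≤ P ∨ J ≤ P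

/-- `I` and `J` are coprime if `I + J = T`. -/
def Coprime (I J : TambaraIdeal T) : Prop := I ⊔ J = ⊤

end TambaraIdeal

/-- The set `RadId_G(T)` of radical Tambara ideals, ordered by inclusion. -/
def RadId (T : TambaraFunctor.{u, v} G) : Type (max u v) :=
  {I : TambaraIdeal T // I.IsRadical}

instance (T : TambaraFunctor.{u, v} G) : PartialOrder (RadId T) :=
  inferInstanceAs (PartialOrder {I : TambaraIdeal T // I.IsRadical})

/-- Levelwise intersection of radical Tambara ideals. -/
instance (T : TambaraFunctor.{u, v} G) : InfSet (RadId T) where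
  sInf S := ⟨sInf (Subtype.val '' S), TambaraIdeal.isRadical_sInf _ (by
    rintro _ ⟨I, -, rfl⟩
    exact I.2)⟩

theorem RadId.isGLB_sInf {T : TambaraFunctor.{u, v} G} (S : Set (RadId T)) : IsGLB S (sInf S) :=
  ⟨fun I hI => (TambaraIdeal.isGLB_sInf (Subtype.val '' S)).1 ⟨I, hI, rfl⟩,
    fun _ hJ => (TambaraIdeal.isGLB_sInf (Subtype.val '' S)).2 (by
      rintro _ ⟨I, hI, rfl⟩
      exact hJ hI)⟩

/-- The inclusion order makes `RadId_G(T)` a complete lattice, meets being intersections. -/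
instance (T : TambaraFunctor.{u, v} G) : CompleteLattice (RadId T) :=
  completeLatticeOfInf (RadId T) RadId.isGLB_sInf

/-- The set of Nakaoka prime ideals of `T`. -/
def NakSpec (T : TambaraFunctor.{u, v} G) : Type (max u v) :=
  {P : TambaraIdeal T // P.IsPrime}

/-- The topology whose subbasic open sets are `D_H(x) = {P | x ∉ P(G/H)}`. -/
instance (T : TambaraFunctor.{u, v} G) : TopologicalSpace (NakSpec T) :=
  TopologicalSpace.generateFrom
    {U | ∃ (H : Subgroup G) (x : T.obj H), U = {P : NakSpec T | x ∉ P.1.lvl H}}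

section Quotient

variable {T : TambaraFunctor.{u, v} G} (I : TambaraIdeal T)

theorem TambaraIdeal.nmConj_sub_mem (L : Subgroup G) (g : G) {H : Subgroup G} {x y : T.obj H}
    (hx : x ∈ I.lvl H) (hy : y ∈ I.lvl H) : T.nmConj L g H x - T.nmConj L g H y ∈ I.lvl L :=
  Ideal.sub_mem _ (I.nmConj_mem L g hx) (I.nmConj_mem L g hy)

/-- Norms are compatible with congruence modulo a Tambara ideal. -/
theorem TambaraIdeal.nm_sub_mem {K H : Subgroup G} (h : K ≤ H) {x y : T.obj K}
    (hxy : x - y ∈ I.lvl K) : T.nm h x - T.nm h y ∈ I.lvl H := by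
  have h₁ : x = y + (x - y) := by ring
  have h₂ : T.nm h y = T.nm h (y + 0) := by rw [add_zero]
  rw [h₂, h₁, T.nm_add, T.nm_add, ← Finset.sum_sub_distrib]
  refine Ideal.sum_mem _ fun o _ => ?_
  rw [PreTambara.sumTerm, PreTambara.sumTerm, ← map_sub]
  refine I.tr_mem _ ?_
  rw [← Ideal.Quotient.mk_eq_mk_iff_sub_mem, map_prod, map_prod]
  refine Finset.prod_congr rfl fun q _ => ?_
  rw [Ideal.Quotient.mk_eq_mk_iff_sub_mem]
  split_ifs with hF
  · rw [sub_self]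
    exact Submodule.zero_mem _
  · exact I.nmConj_sub_mem _ _ hxy (Submodule.zero_mem _)

/-- The levelwise quotient rings `T(G/H) / I(G/H)`, with the induced structure maps. -/
def TambaraIdeal.preQuotient : PreTambara.{u, v} G where
  obj H := T.obj H ⧸ I.lvl H
  res {K H} h := Ideal.quotientMap (I.lvl K) (T.res h) fun _ hx => I.res_mem h hx
  tr {K H} h := QuotientAddGroup.map (I.lvl K).toAddSubgroup (I.lvl H).toAddSubgroup (T.tr h)
    fun _ hx => I.tr_mem h hx
  nm {K H} h :=
    { toFun := Quotient.map' (T.nm h) fun x y hxy => by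
        rw [Submodule.quotientRel_def] at hxy ⊢
        exact I.nm_sub_mem h hxy
      map_one' := congrArg (Ideal.Quotient.mk (I.lvl H)) (map_one (T.nm h))
      map_mul' := by
        intro x y
        obtain ⟨x, rfl⟩ := Ideal.Quotient.mk_surjective x
        obtain ⟨y, rfl⟩ := Ideal.Quotient.mk_surjective y
        exact congrArg (Ideal.Quotient.mk (I.lvl H)) (map_mul (T.nm h) x y) }
  c g {H K} e := Ideal.quotientMap (I.lvl K) (T.c g e) fun _ hx => I.c_mem g e hx

/-- The quotient map `T(G/H) → T(G/H) / I(G/H)`. -/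
def TambaraIdeal.proj (H : Subgroup G) : T.obj H →+* I.preQuotient.obj H :=
  Ideal.Quotient.mk (I.lvl H)

theorem TambaraIdeal.proj_surjective (H : Subgroup G) : Function.Surjective (I.proj H) :=
  Ideal.Quotient.mk_surjective

theorem TambaraIdeal.proj_res {K H : Subgroup G} (h : K ≤ H) (x : T.obj H) :
    I.preQuotient.res h (I.proj H x) = I.proj K (T.res h x) := rfl

theorem TambaraIdeal.proj_tr {K H : Subgroup G} (h : K ≤ H) (x : T.obj K) :
    I.preQuotient.tr h (I.proj K x) = I.proj H (T.tr h x) := rfl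

theorem TambaraIdeal.proj_nm {K H : Subgroup G} (h : K ≤ H) (x : T.obj K) :
    I.preQuotient.nm h (I.proj K x) = I.proj H (T.nm h x) := rfl

theorem TambaraIdeal.proj_c (g : G) {H K : Subgroup G} (e : K = conj g H) (x : T.obj H) :
    I.preQuotient.c g e (I.proj H x) = I.proj K (T.c g e x) := rfl

theorem TambaraIdeal.proj_trConj (L : Subgroup G) (g : G) (H : Subgroup G) (x : T.obj H) :
    I.preQuotient.trConj L g H (I.proj H x) = I.proj L (T.trConj L g H x) := rfl

theorem TambaraIdeal.proj_nmConj (L : Subgroup G) (g : G) (H : Subgroup G) (x : T.obj H) :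
    I.preQuotient.nmConj L g H (I.proj H x) = I.proj L (T.nmConj L g H x) := rfl

theorem TambaraIdeal.proj_sumTerm (K H : Subgroup G) (a b : T.obj K) (F : Colouring K H) :
    I.preQuotient.sumTerm K H (I.proj K a) (I.proj K b) F = I.proj H (T.sumTerm K H a b F) := by
  rw [PreTambara.sumTerm, PreTambara.sumTerm, ← I.proj_tr, map_prod (I.proj _)]
  simp only [← apply_ite (I.proj K), I.proj_nmConj]

theorem TambaraIdeal.proj_transferTerm {L K : Subgroup G} (h : L ≤ K) (H : Subgroup G)
    (b : T.obj L) (s : CosetSection h H) :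
    I.preQuotient.transferTerm h H (I.proj L b) s = I.proj H (T.transferTerm h H b s) := by
  rw [PreTambara.transferTerm, PreTambara.transferTerm, ← I.proj_tr, map_prod (I.proj _)]
  simp only [I.proj_nmConj]

/-- The quotient Tambara functor `T / I`. -/
def TambaraIdeal.quotient : TambaraFunctor.{u, v} G where
  toPreTambara := I.preQuotient
  res_self x := by
    obtain ⟨x, rfl⟩ := I.proj_surjective _ x
    rw [I.proj_res, T.res_self]
  tr_self x := by
    obtain ⟨x, rfl⟩ := I.proj_surjective _ x
    rw [I.proj_tr, T.tr_self]
  nm_self x := by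
    obtain ⟨x, rfl⟩ := I.proj_surjective _ x
    rw [I.proj_nm, T.nm_self]
  res_res h₁ h₂ x := by
    obtain ⟨x, rfl⟩ := I.proj_surjective _ x
    rw [I.proj_res, I.proj_res, I.proj_res, T.res_res]
  tr_tr h₁ h₂ x := by
    obtain ⟨x, rfl⟩ := I.proj_surjective _ x
    rw [I.proj_tr, I.proj_tr, I.proj_tr, T.tr_tr]
  nm_nm h₁ h₂ x := by
    obtain ⟨x, rfl⟩ := I.proj_surjective _ x
    rw [I.proj_nm, I.proj_nm, I.proj_nm, T.nm_nm]
  c_c e₁ e₂ e₃ x := by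
    obtain ⟨x, rfl⟩ := I.proj_surjective _ x
    rw [I.proj_c, I.proj_c, I.proj_c, T.c_c e₁ e₂ e₃]
  c_of_mem h e x := by
    obtain ⟨x, rfl⟩ := I.proj_surjective _ x
    rw [I.proj_c, T.c_of_mem h]
  c_res h h' eK eH x := by
    obtain ⟨x, rfl⟩ := I.proj_surjective _ x
    rw [I.proj_res, I.proj_c, I.proj_c, I.proj_res, T.c_res h h' eK eH]
  c_nm h h' eK eH x := by
    obtain ⟨x, rfl⟩ := I.proj_surjective _ x
    rw [I.proj_nm, I.proj_c, I.proj_c, I.proj_nm, T.c_nm h h' eK eH]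
  c_tr h h' eK eH x := by
    obtain ⟨x, rfl⟩ := I.proj_surjective _ x
    rw [I.proj_tr, I.proj_c, I.proj_c, I.proj_tr, T.c_tr h h' eK eH]
  res_tr hL hH x := by
    obtain ⟨x, rfl⟩ := I.proj_surjective _ x
    rw [I.proj_tr, I.proj_res, T.res_tr, map_sum]
    simp only [I.proj_trConj]
  res_nm hL hH x := by
    obtain ⟨x, rfl⟩ := I.proj_surjective _ x
    rw [I.proj_nm, I.proj_res, T.res_nm, map_prod]
    simp only [I.proj_nmConj]
  frobenius h x y := by
    obtain ⟨x, rfl⟩ := I.proj_surjective _ x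
    obtain ⟨y, rfl⟩ := I.proj_surjective _ y
    rw [I.proj_res, I.proj_tr, ← map_mul, ← map_mul, I.proj_tr, T.frobenius]
  nm_zero h := by
    rw [← map_zero (I.proj _), I.proj_nm, T.nm_zero, map_zero]
  nm_add h a b := by
    obtain ⟨a, rfl⟩ := I.proj_surjective _ a
    obtain ⟨b, rfl⟩ := I.proj_surjective _ b
    rw [← map_add, I.proj_nm, T.nm_add, map_sum]
    simp only [I.proj_sumTerm]
  nm_tr h₁ h₂ b := by
    obtain ⟨b, rfl⟩ := I.proj_surjective _ b
    rw [I.proj_tr, I.proj_nm, T.nm_tr, map_sum]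
    simp only [I.proj_transferTerm]

end Quotient

/-- The nilradical `√0`. -/
def nilradical (T : TambaraFunctor.{u, v} G) : TambaraIdeal T := TambaraIdeal.radical ⊥

/-- The reduction `T_red = T / √0`. -/
def reduction (T : TambaraFunctor.{u, v} G) : TambaraFunctor.{u, v} G := (nilradical T).quotient

end Tamb

namespace Tamb

variable {G : Type v} [Group G]

/-! Each of the four conditions amounts to the existence of Tambara ideals `I ≠ ⊤`, `J ≠ ⊤` of `T`
with `I + J = T` and `I ∩ J ⊆ √0`. The primes above `I` and those above `J` then partition the
spectrum into two nonempty closed sets. The radicals of `I` and `J` are complements in `RadId T`.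
Images of complementary radical ideals in `T_red` are coprime and meet in zero, so `T_red` splits by
the Chinese remainder theorem. Conversely, the kernels of the two projections of a splitting of
`T_red`, pulled back to `T`, form such a pair.

Passing between ideals and points takes two facts. Every `I ≠ ⊤` lies in a prime
(`exists_isPrime_of_ne_top`), so `I` and `J` are coprime exactly when no prime contains both. And
`√I` is the intersection of the primes above `I` (`radical_eq_sInf`), so `I ∩ J ⊆ √0` exactly when
every prime contains `I` or `J`. Primes come from ordinary ones: for a prime `p` of `T(G/K)`, the
largest Tambara ideal with `K`-level inside `p` is prime (`isPrime_coinduced`).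

The hard point is `mem_radical_of_lvl_le`. If `x` lies in every prime above `I`, then every element
of every level of `⟨x⟩` has a power in `I`, but a single `n` with `⟨x⟩ⁿ ⊆ I` is required, and
Tambara products are only generated by levelwise products. An explicit description helps: `⟨x⟩` lies
in the ideal of sums of transfers of multiples of the elements `N r c_g x`, of which there are
finitely many per level. By Frobenius reciprocity and the double coset formula, `⟨x⟩ⁿ` lies in the
ideal of sums of transfers of `n`-fold products of such multiples, and finiteness gives a uniform
exponent. -/

theorem conj_conj (g h : G) (H : Subgroup G) : conj g (conj h H) = conj (g * h) H := by
  ext x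
  simp [conj, Subgroup.mem_map, mul_assoc]

theorem conj_mono (g : G) {K H : Subgroup G} (h : K ≤ H) : conj g K ≤ conj g H :=
  Subgroup.map_mono h

theorem card_conj (g : G) (H : Subgroup G) : Nat.card (conj g H) = Nat.card H :=
  (Nat.card_congr (H.equivMapOfInjective _ (MulAut.conj g).injective).toEquiv).symm

variable [Finite G]

/-- A family of subsets of the rings `T(G/H)` closed under multiplication by scalars,
restrictions, norms and conjugations. -/
structure MulFamily (T : TambaraFunctor.{u, v} G) where
  lvl : ∀ H, Set (T.obj H)
  mul_mem : ∀ {H} (r : T.obj H) {x : T.obj H}, x ∈ lvl H → r * x ∈ lvl H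
  res_mem : ∀ {K H} (h : K ≤ H) {x : T.obj H}, x ∈ lvl H → T.res h x ∈ lvl K
  nm_mem : ∀ {K H} (h : K ≤ H) {x : T.obj K}, x ∈ lvl K → T.nm h x ∈ lvl H
  c_mem : ∀ (g : G) {H K} (e : K = conj g H) {x : T.obj H}, x ∈ lvl H → T.c g e x ∈ lvl K

/-! ### Tambara ideals generated by transfers of a multiplicative family -/

namespace MulFamily

variable {T : TambaraFunctor.{u, v} G} (S : MulFamily T)

theorem mem_of_dvd {H : Subgroup G} {x y : T.obj H} (hx : x ∈ S.lvl H) (h : x ∣ y) :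
    y ∈ S.lvl H := by
  obtain ⟨r, rfl⟩ := h
  rw [mul_comm]
  exact S.mul_mem r hx

/-- The ideal of `T(G/H)` generated by the transfers of elements of the family. -/
def trIdeal (H : Subgroup G) : Ideal (T.obj H) :=
  Ideal.span {y | ∃ (K : Subgroup G) (h : K ≤ H) (s : T.obj K), s ∈ S.lvl K ∧ y = T.tr h s}

theorem tr_mem_trIdeal {K H : Subgroup G} (h : K ≤ H) {s : T.obj K} (hs : s ∈ S.lvl K) :
    T.tr h s ∈ S.trIdeal H :=
  Ideal.subset_span ⟨K, h, s, hs, rfl⟩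

theorem mem_trIdeal {H : Subgroup G} {s : T.obj H} (hs : s ∈ S.lvl H) : s ∈ S.trIdeal H := by
  have := S.tr_mem_trIdeal le_rfl hs
  rwa [T.tr_self] at this

theorem trIdeal_res {K H : Subgroup G} (h : K ≤ H) {x : T.obj H} (hx : x ∈ S.trIdeal H) :
    T.res h x ∈ S.trIdeal K := by
  induction hx using Submodule.span_induction with
  | mem x hx =>
    obtain ⟨L, hL, s, hs, rfl⟩ := hx
    rw [T.res_tr]
    exact Ideal.sum_mem _ fun q _ => S.tr_mem_trIdeal _ (S.res_mem _ (S.c_mem _ _ hs))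
  | zero => rw [map_zero]; exact Ideal.zero_mem _
  | add x y _ _ hx hy => rw [map_add]; exact Ideal.add_mem _ hx hy
  | smul r x _ hx => rw [smul_eq_mul, map_mul]; exact Ideal.mul_mem_left _ _ hx

theorem trIdeal_c (g : G) {H K : Subgroup G} (e : K = conj g H) {x : T.obj H}
    (hx : x ∈ S.trIdeal H) : T.c g e x ∈ S.trIdeal K := by
  induction hx using Submodule.span_induction with
  | mem x hx =>
    obtain ⟨L, hL, s, hs, rfl⟩ := hx
    rw [T.c_tr hL (e ▸ conj_mono g hL) rfl e]
    exact S.tr_mem_trIdeal _ (S.c_mem _ _ hs)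
  | zero => rw [map_zero]; exact Ideal.zero_mem _
  | add x y _ _ hx hy => rw [map_add]; exact Ideal.add_mem _ hx hy
  | smul r x _ hx => rw [smul_eq_mul, map_mul]; exact Ideal.mul_mem_left _ _ hx

/-- A transfer is not linear over the ring, so induction on the span needs the statement for all
multiples `r * x`. Frobenius reciprocity moves `r` inside the transfer of a generator, where the
family absorbs it. -/
theorem trIdeal_tr {K H : Subgroup G} (h : K ≤ H) {x : T.obj K} (hx : x ∈ S.trIdeal K) :
    T.tr h x ∈ S.trIdeal H := by
  suffices ∀ r, T.tr h (r * x) ∈ S.trIdeal H by simpa using this 1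
  induction hx using Submodule.span_induction with
  | mem x hx =>
    obtain ⟨L, hL, s, hs, rfl⟩ := hx
    intro r
    rw [← T.frobenius, T.tr_tr]
    exact S.tr_mem_trIdeal _ (S.mul_mem _ hs)
  | zero => intro r; rw [mul_zero, map_zero]; exact Ideal.zero_mem _
  | add x y _ _ hx hy => intro r; rw [mul_add, map_add]; exact Ideal.add_mem _ (hx r) (hy r)
  | smul a x _ hx => intro r; rw [smul_eq_mul, ← mul_assoc]; exact hx _

/-- By Tambara reciprocity this is a sum of transfers of products. Each product runs over a nonempty
set of double cosets, and a single factor in the family puts the whole product in it. -/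
theorem nm_tr_mem_trIdeal {L K H : Subgroup G} (h₁ : L ≤ K) (h₂ : K ≤ H) {s : T.obj L}
    (hs : s ∈ S.lvl L) : T.nm h₂ (T.tr h₁ s) ∈ S.trIdeal H := by
  rw [T.nm_tr]
  refine Ideal.sum_mem _ fun o _ => S.tr_mem_trIdeal _ ?_
  exact S.mem_of_dvd (S.nm_mem _ (S.res_mem _ (S.c_mem _ _ hs)))
    (Finset.dvd_prod_of_mem _ (Finset.mem_univ default))

/-- Norms are not additive, so there are two nested inductions: on the order of `K`, and on the
span. In `N(x + y)` every summand is a transfer of a product having a factor that is a norm of a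
restricted conjugate of `x` or `y`. Either that restriction is to a proper subgroup, which has
smaller order, or it is trivial and the factor is a norm of a conjugate. -/
theorem trIdeal_nm {K H : Subgroup G} (h : K ≤ H) {x : T.obj K} (hx : x ∈ S.trIdeal K) :
    T.nm h x ∈ S.trIdeal H := by
  induction hn : Nat.card K using Nat.strong_induction_on generalizing K H with
  | _ n ih =>
  -- The claim is strengthened to all conjugates of `x` and all targets `H'`, because the
  -- reciprocity formula produces norms of conjugates into stabilizers.
  suffices ∀ (g : G) {K' H' : Subgroup G} (e : K' = conj g K) (h' : K' ≤ H'),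
      T.nm h' (T.c g e x) ∈ S.trIdeal H' by
    simpa [T.c_eq_one rfl] using this 1 (conj_of_eq_one rfl K) h
  have key : ∀ y ∈ S.trIdeal K, (∀ (g : G) {K' H' : Subgroup G} (e : K' = conj g K)
      (h' : K' ≤ H'), T.nm h' (T.c g e y) ∈ S.trIdeal H') →
      ∀ (g k : G) {K' : Subgroup G} (L : Subgroup G) (e : K' = conj g K),
        T.nmConj L k K' (T.c g e y) ∈ S.trIdeal L := by
    intro y hy hp g k K' L e
    by_cases hL : L ⊓ conj k K' = conj k K'
    · have : T.nmConj L k K' (T.c g e y) =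
          T.nm inf_le_left (T.c (k * g) (by rw [hL, e, conj_conj]) y) := by
        rw [PreTambara.nmConj, PreTambara.resConj, ← T.c_res le_rfl inf_le_right hL rfl, T.res_self,
          T.c_c]
      rw [this]
      exact hp _ _ _
    -- Here the intersection is a proper subgroup of a conjugate of `K`, so the induction on the
    -- order applies. It needs only membership in `trIdeal`, which restriction and conjugation
    -- preserve.
    · refine ih _ ?_ inf_le_left (S.trIdeal_res _ (S.trIdeal_c _ _ (S.trIdeal_c _ _ hy))) rfl
      have hlt : L ⊓ conj k K' < conj k K' := lt_of_le_of_ne inf_le_right hL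
      have := Set.ncard_lt_ncard (s := ((L ⊓ conj k K' : Subgroup G) : Set G))
        (t := (conj k K' : Set G)) hlt
      rw [← hn, ← card_conj g K, ← e, ← card_conj k K']
      exact this
  induction hx using Submodule.span_induction with
  | mem x hx =>
    obtain ⟨L, hL, s, hs, rfl⟩ := hx
    intro g K' H' e h'
    rw [T.c_tr hL (e ▸ conj_mono g hL) rfl e]
    exact S.nm_tr_mem_trIdeal _ _ (S.c_mem _ _ hs)
  | zero =>
    intro g K' H' e h'
    rw [map_zero, T.nm_zero]
    exact Ideal.zero_mem _
  | add x y hx hy ihx ihy =>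
    intro g K' H' e h'
    rw [map_add, T.nm_add]
    refine Ideal.sum_mem _ fun o _ => S.trIdeal_tr _ ?_
    refine Ideal.mem_of_dvd _ (Finset.dvd_prod_of_mem _ (Finset.mem_univ default)) ?_
    split_ifs
    · exact key x hx ihx _ _ _ _
    · exact key y hy ihy _ _ _ _
  | smul r x _ hx =>
    intro g K' H' e h'
    rw [smul_eq_mul, map_mul, map_mul]
    exact Ideal.mul_mem_left _ _ (hx g e h')

/-- The Tambara ideal generated by a family closed under scalars, restrictions, norms and
conjugations: its elements are sums of transfers of elements of the family. -/
def ideal : TambaraIdeal T where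
  lvl := S.trIdeal
  res_mem h _ hx := S.trIdeal_res h hx
  tr_mem h _ hx := S.trIdeal_tr h hx
  nm_mem h _ hx := S.trIdeal_nm h hx
  c_mem g _ _ e _ hx := S.trIdeal_c g e hx

theorem ideal_le {I : TambaraIdeal T} (h : ∀ H, S.lvl H ⊆ I.lvl H) : S.ideal ≤ I := fun _ =>
  Ideal.span_le.2 (by
    rintro _ ⟨K, hK, s, hs, rfl⟩
    exact I.tr_mem hK (h K hs))

/-- The family of products of elements of two families. -/
def mul (S' : MulFamily T) : MulFamily T where
  lvl H := {y | ∃ s ∈ S.lvl H, ∃ s' ∈ S'.lvl H, y = s * s'}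
  mul_mem r x hx := by
    obtain ⟨s, hs, s', hs', rfl⟩ := hx
    exact ⟨r * s, S.mul_mem r hs, s', hs', (mul_assoc _ _ _).symm⟩
  res_mem h x hx := by
    obtain ⟨s, hs, s', hs', rfl⟩ := hx
    exact ⟨_, S.res_mem h hs, _, S'.res_mem h hs', map_mul _ _ _⟩
  nm_mem h x hx := by
    obtain ⟨s, hs, s', hs', rfl⟩ := hx
    exact ⟨_, S.nm_mem h hs, _, S'.nm_mem h hs', map_mul _ _ _⟩
  c_mem g _ _ e x hx := by
    obtain ⟨s, hs, s', hs', rfl⟩ := hx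
    exact ⟨_, S.c_mem g e hs, _, S'.c_mem g e hs', map_mul _ _ _⟩

theorem ideal_mul_ideal_le (S' : MulFamily T) : S.ideal * S'.ideal ≤ (S.mul S').ideal := by
  refine TambaraIdeal.mul_le_iff.2 fun H => ?_
  change S.trIdeal H * S'.trIdeal H ≤ (S.mul S').trIdeal H
  rw [trIdeal, trIdeal, Ideal.span_mul_span', Ideal.span_le]
  rintro _ ⟨_, ⟨L, hL, s, hs, rfl⟩, _, ⟨M, hM, s', hs', rfl⟩, rfl⟩
  change T.tr hL s * T.tr hM s' ∈ (S.mul S').trIdeal H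
  -- A product of two transfers becomes a transfer of `s` times a restricted transfer of `s'`. The
  -- double coset formula and a second use of Frobenius turn it into a sum of transfers of products.
  rw [mul_comm, ← T.frobenius, T.res_tr, Finset.sum_mul, map_sum]
  refine Ideal.sum_mem _ fun q _ => ?_
  rw [mul_comm, PreTambara.trConj, ← T.frobenius, T.tr_tr]
  exact (S.mul S').tr_mem_trIdeal _
    ⟨_, S.res_mem _ hs, _, S'.res_mem _ (S'.c_mem _ _ hs'), rfl⟩

/-- The family of products of `n + 1` elements of `S`. -/
def powSucc : ℕ → MulFamily T
  | 0 => S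
  | n + 1 => (powSucc n).mul S

theorem power_le_ideal_powSucc {I : TambaraIdeal T} (h : I ≤ S.ideal) :
    ∀ n, I.power (n + 1) ≤ (S.powSucc n).ideal
  | 0 => h
  | n + 1 => (TambaraIdeal.mul_mono (power_le_ideal_powSucc h n) h).trans
      (ideal_mul_ideal_le _ _)

theorem powSucc_subset {A : ∀ H, Ideal (T.obj H)} (h : ∀ H, S.lvl H ⊆ A H) (H : Subgroup G) :
    ∀ n, (S.powSucc n).lvl H ⊆ (A H ^ (n + 1) : Ideal (T.obj H))
  | 0 => by rw [zero_add, pow_one]; exact h H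
  | n + 1 => by
    rintro _ ⟨s, hs, s', hs', rfl⟩
    rw [pow_succ]
    exact Ideal.mul_mem_mul (powSucc_subset h H n hs) (h H hs')

end MulFamily

/-! ### The multiplicative family generated by one element -/

namespace TambaraFunctor

variable (T : TambaraFunctor.{u, v} G)

/-- The elements `N^K_L r^{gHg⁻¹}_L c_{g,H} x` of `T(G/K)`. -/
def normTranslates {H : Subgroup G} (x : T.obj H) (K : Subgroup G) : Set (T.obj K) :=
  {y | ∃ (g : G) (L : Subgroup G) (h : L ≤ K) (h' : L ≤ conj g H),
    y = T.nm h (T.res h' (T.c g rfl x))}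

variable {T} {H : Subgroup G} (x : T.obj H)

theorem mem_normTranslates {g : G} {L K H' : Subgroup G} (e : H' = conj g H) (h : L ≤ K)
    (h' : L ≤ H') : T.nm h (T.res h' (T.c g e x)) ∈ T.normTranslates x K := by
  subst e
  exact ⟨g, L, h, h', rfl⟩

theorem finite_normTranslates (K : Subgroup G) : (T.normTranslates x K).Finite := by
  have : T.normTranslates x K = ⋃ (g : G), ⋃ (L : Subgroup G), ⋃ (h : L ≤ K),
      ⋃ (h' : L ≤ conj g H), {T.nm h (T.res h' (T.c g rfl x))} := by
    ext y
    simp [normTranslates]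
  rw [this]
  exact Set.finite_iUnion fun _ => Set.finite_iUnion fun _ => Set.finite_iUnion fun _ =>
    Set.finite_iUnion fun _ => Set.finite_singleton _

theorem self_mem_normTranslates : x ∈ T.normTranslates x H := by
  have := mem_normTranslates x (conj_of_eq_one rfl H) le_rfl le_rfl
  rwa [T.c_eq_one rfl, T.res_self, T.nm_self] at this

variable (T) in
/-- The multiples of the elements `N^K_L r^{gHg⁻¹}_L c_{g,H} x`. -/
def normFamily {H : Subgroup G} (x : T.obj H) : MulFamily T where
  lvl K := {y | ∃ z ∈ T.normTranslates x K, z ∣ y}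
  mul_mem r y hy := by
    obtain ⟨z, hz, hy⟩ := hy
    exact ⟨z, hz, hy.mul_left r⟩
  res_mem {K K'} h y hy := by
    obtain ⟨_, ⟨g, L, hL, hL', rfl⟩, hy⟩ := hy
    -- The restriction of a norm is a product over double cosets. Since multiples are allowed, it is
    -- enough that one factor is again a norm of a restricted conjugate of `x`.
    refine ⟨_, ?_, (Finset.dvd_prod_of_mem _ (Finset.mem_univ default)).trans
      ((T.res_nm h hL _).symm.dvd.trans (map_dvd (T.res h) hy))⟩
    rw [PreTambara.nmConj, PreTambara.resConj, T.c_res hL' (conj_mono _ hL') rfl rfl, T.res_res,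
      T.c_c _ _ (conj_conj _ _ _)]
    exact mem_normTranslates x _ _ _
  nm_mem h y hy := by
    obtain ⟨_, ⟨g, L, hL, hL', rfl⟩, hy⟩ := hy
    refine ⟨_, ?_, map_dvd (T.nm h) hy⟩
    rw [T.nm_nm]
    exact mem_normTranslates x _ _ _
  c_mem g K K' e y hy := by
    obtain ⟨_, ⟨g', L, hL, hL', rfl⟩, hy⟩ := hy
    refine ⟨_, ?_, map_dvd (T.c g e) hy⟩
    rw [T.c_nm hL (e ▸ conj_mono g hL) rfl e, T.c_res hL' (conj_mono _ hL') rfl rfl,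
      T.c_c _ _ (conj_conj _ _ _)]
    exact mem_normTranslates x _ _ _

theorem normTranslates_subset_principal (K : Subgroup G) :
    T.normTranslates x K ⊆ (TambaraIdeal.principal x).lvl K := by
  rintro _ ⟨g, L, h, h', rfl⟩
  exact TambaraIdeal.nm_mem _ _ (TambaraIdeal.res_mem _ _ (TambaraIdeal.c_mem _ _ _
    (TambaraIdeal.mem_principal x)))

theorem principal_le_normFamily : TambaraIdeal.principal x ≤ (T.normFamily x).ideal :=
  TambaraIdeal.principal_le_iff.2
    ((T.normFamily x).mem_trIdeal ⟨x, self_mem_normTranslates x, dvd_rfl⟩)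

end TambaraFunctor

/-! ### From levelwise nilpotence to the Tambara radical -/

namespace TambaraIdeal

variable {T : TambaraFunctor.{u, v} G}

/-- `√I` contains `x` as soon as `⟨x⟩` is levelwise contained in the radical of `I`. -/
theorem mem_radical_of_lvl_le {I : TambaraIdeal T} {H : Subgroup G} {x : T.obj H}
    (h : ∀ K, (principal x).lvl K ≤ (I.lvl K).radical) : x ∈ (radical I).lvl H := by
  -- At each level the finitely many norm translates generate a finitely generated ideal inside the
  -- radical of `I.lvl K`, so one power of it lies in `I.lvl K`.
  have hfg : ∀ K, ∃ n, Ideal.span (T.normTranslates x K) ^ n ≤ I.lvl K := fun K =>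
    Ideal.exists_pow_le_of_le_radical_of_fg
      (Ideal.span_le.2 ((TambaraFunctor.normTranslates_subset_principal x K).trans (h K)))
      (Submodule.fg_span (TambaraFunctor.finite_normTranslates x K))
  choose n hn using hfg
  -- As `G` has finitely many subgroups, one bound `N` serves all levels. The exponent is `N + 1`
  -- because `powSucc N` consists of products of `N + 1` elements.
  obtain ⟨N, hN⟩ := (Set.finite_range n).bddAbove
  refine ⟨N + 1, by omega, ((T.normFamily x).power_le_ideal_powSucc
    (TambaraFunctor.principal_le_normFamily x) N).trans (MulFamily.ideal_le _ fun K => ?_)⟩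
  refine ((T.normFamily x).powSucc_subset (A := fun K => Ideal.span (T.normTranslates x K))
    ?_ K N).trans ?_
  · rintro K y ⟨z, hz, hy⟩
    exact Ideal.mem_of_dvd _ hy (Ideal.subset_span hz)
  · have : n K ≤ N + 1 := (hN ⟨K, rfl⟩).trans N.le_succ
    exact fun y hy => hn K (Ideal.pow_le_pow_right this hy)

end TambaraIdeal

end Tamb

namespace Tamb

variable {G : Type v} [Group G] [Finite G]

/-! ### Prime Tambara ideals and the radical -/

namespace TambaraIdeal

variable {T : TambaraFunctor.{u, v} G}

theorem eq_top_of_one_mem {I : TambaraIdeal T} (h : (1 : T.obj ⊤) ∈ I.lvl ⊤) : I = ⊤ := by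
  refine top_le_iff.1 fun H x _ => ?_
  have := I.res_mem (le_top : H ≤ ⊤) h
  rw [map_one] at this
  exact (Ideal.eq_top_iff_one _).2 this ▸ trivial

theorem IsPrime.ne_top {P : TambaraIdeal T} (h : P.IsPrime) : P ≠ ⊤ := by
  rintro rfl
  exact h.1 trivial

theorem mul_le_inf (I J : TambaraIdeal T) : I * J ≤ I ⊓ J :=
  mul_le_iff.2 fun _ => Ideal.mul_le_inf

theorem principal_add_le {H : Subgroup G} (x y : T.obj H) :
    principal (x + y) ≤ principal x ⊔ principal y :=
  principal_le_iff.2 (Submodule.add_mem_sup (mem_principal x) (mem_principal y))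

/-- The largest Tambara ideal whose level at `K` is contained in the ideal `p`. -/
def coinduced (K : Subgroup G) (p : Ideal (T.obj K)) : TambaraIdeal T where
  lvl H :=
    { carrier := {x | (principal x).lvl K ≤ p}
      add_mem' := fun hx hy => (principal_add_le _ _ K).trans (sup_le hx hy)
      zero_mem' := (principal_le_iff.2 (Submodule.zero_mem _) :
        principal (0 : T.obj H) ≤ ⊥) K |>.trans bot_le
      smul_mem' := fun r _ hx => le_trans (principal_le_iff.2
        (Ideal.mul_mem_left _ r (mem_principal _)) K) hx }
  res_mem h _ hx := le_trans (principal_le_iff.2 (res_mem _ h (mem_principal _)) K) hx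
  tr_mem h _ hx := le_trans (principal_le_iff.2 (tr_mem _ h (mem_principal _)) K) hx
  nm_mem h _ hx := le_trans (principal_le_iff.2 (nm_mem _ h (mem_principal _)) K) hx
  c_mem g _ _ e _ hx := le_trans (principal_le_iff.2 (c_mem _ g e (mem_principal _)) K) hx

/-- This is the adjunction between `coinduced K` and evaluation at level `K`; it reduces
containments of Tambara ideals to one ordinary ring. -/
theorem le_coinduced_iff {K : Subgroup G} {p : Ideal (T.obj K)} {I : TambaraIdeal T} :
    I ≤ coinduced K p ↔ I.lvl K ≤ p :=
  ⟨fun h x hx => (h K hx : (principal x).lvl K ≤ p) (mem_principal x),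
    fun h _ _ hx => ((principal_le_iff.2 hx) K).trans h⟩

/-- By adjunction, `I * J ≤ coinduced K p` gives `I.lvl K * J.lvl K ≤ p`, since the product contains
the levelwise products; primality of `p` then decides. -/
theorem isPrime_coinduced (K : Subgroup G) (p : Ideal (T.obj K)) [hp : p.IsPrime] :
    (coinduced K p).IsPrime := by
  refine ⟨fun h => hp.ne_top (top_le_iff.1 ?_), fun I J h => ?_⟩
  · exact le_coinduced_iff.1 (eq_top_of_one_mem h).ge
  · simp only [le_coinduced_iff] at h ⊢
    exact hp.mul_le.1 ((mul_le_iff.1 le_rfl K).trans h)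

theorem exists_isPrime_of_ne_top {I : TambaraIdeal T} (h : I ≠ ⊤) : ∃ P, P.IsPrime ∧ I ≤ P := by
  have : I.lvl ⊤ ≠ ⊤ := fun h' => h (eq_top_of_one_mem (h' ▸ trivial))
  obtain ⟨p, hp, hI⟩ := Ideal.exists_le_maximal _ this
  have := hp.isPrime
  exact ⟨_, isPrime_coinduced ⊤ p, le_coinduced_iff.2 hI⟩

theorem IsPrime.le_of_power_le {P I : TambaraIdeal T} (hP : P.IsPrime) :
    ∀ n, power I n ≤ P → I ≤ P
  | 0, h => le_top.trans h
  | 1, h => h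
  | n + 2, h => (hP.2 _ _ h).elim (hP.le_of_power_le (n + 1)) id

theorem IsPrime.isRadical {P : TambaraIdeal T} (hP : P.IsPrime) : P.IsRadical :=
  le_antisymm (le_radical P) fun _ _ ⟨n, _, hx⟩ => principal_le_iff.1 (hP.le_of_power_le n hx)

theorem radical_mono {I J : TambaraIdeal T} (h : I ≤ J) : radical I ≤ radical J :=
  fun _ _ ⟨n, hn, hx⟩ => ⟨n, hn, hx.trans h⟩

theorem IsRadical.radical_le_iff {I J : TambaraIdeal T} (hJ : J.IsRadical) :
    radical I ≤ J ↔ I ≤ J :=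
  ⟨(le_radical I).trans, fun h => (radical_mono h).trans hJ.ge⟩

/-- The radical is the intersection of the prime ideals above. -/
theorem radical_eq_sInf (I : TambaraIdeal T) : radical I = sInf {P | P.IsPrime ∧ I ≤ P} := by
  refine le_antisymm (le_sInf fun P hP => hP.1.isRadical.radical_le_iff.2 hP.2) fun H x hx => ?_
  -- It remains to test each level against the ordinary primes `p` above `I.lvl K`. The coinduced
  -- ideal of `p` is a prime above `I`, hence contains `x`.
  refine mem_radical_of_lvl_le fun K => ?_
  rw [Ideal.radical_eq_sInf]
  refine le_sInf fun p hp => ?_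
  have := hp.2
  exact le_coinduced_iff.1 (principal_le_iff.2
    (mem_sInf.1 hx _ ⟨isPrime_coinduced K p, le_coinduced_iff.2 hp.1⟩))

theorem le_radical_iff {I J : TambaraIdeal T} :
    J ≤ radical I ↔ ∀ P : TambaraIdeal T, P.IsPrime → I ≤ P → J ≤ P := by
  rw [radical_eq_sInf, le_sInf_iff]
  exact ⟨fun h P hP hI => h P ⟨hP, hI⟩, fun h P hP => h P hP.1 hP.2⟩

theorem isRadical_radical (I : TambaraIdeal T) : (radical I).IsRadical := by
  rw [radical_eq_sInf]
  exact isRadical_sInf _ fun P hP => hP.1.isRadical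

theorem nilradical_le_prime {P : TambaraIdeal T} (hP : P.IsPrime) : nilradical T ≤ P :=
  hP.isRadical.radical_le_iff.2 bot_le

theorem coprime_iff {I J : TambaraIdeal T} :
    I.Coprime J ↔ ∀ P : TambaraIdeal T, P.IsPrime → ¬ (I ≤ P ∧ J ≤ P) := by
  constructor
  · rintro h P hP ⟨hI, hJ⟩
    exact hP.ne_top (top_le_iff.1 (h.ge.trans (sup_le hI hJ)))
  · intro h
    by_contra h'
    obtain ⟨P, hP, hle⟩ := exists_isPrime_of_ne_top h'
    exact h P hP ⟨le_sup_left.trans hle, le_sup_right.trans hle⟩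

theorem IsPrime.inf_le {P I J : TambaraIdeal T} (hP : P.IsPrime) :
    I ⊓ J ≤ P ↔ I ≤ P ∨ J ≤ P :=
  ⟨fun h => hP.2 _ _ ((mul_le_inf I J).trans h),
    fun h => h.elim inf_le_left.trans inf_le_right.trans⟩

theorem inf_le_nilradical_iff {I J : TambaraIdeal T} :
    I ⊓ J ≤ nilradical T ↔ ∀ P : TambaraIdeal T, P.IsPrime → I ≤ P ∨ J ≤ P := by
  rw [nilradical, le_radical_iff]
  exact ⟨fun h P hP => hP.inf_le.1 (h P hP bot_le), fun h P hP _ => hP.inf_le.2 (h P hP)⟩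

end TambaraIdeal

/-! ### Disconnections of the spectrum and pairs of ideals -/

namespace NakSpec

variable {T : TambaraFunctor.{u, v} G}

/-- The set of primes containing `I`. -/
def zeroLocus (I : TambaraIdeal T) : Set (NakSpec T) := {P | I ≤ P.1}

theorem isOpen_compl_zeroLocus (I : TambaraIdeal T) : IsOpen (zeroLocus I)ᶜ := by
  have : (zeroLocus I)ᶜ = ⋃ (H : Subgroup G), ⋃ x ∈ I.lvl H, {P : NakSpec T | x ∉ P.1.lvl H} := by
    ext P
    simp [zeroLocus, TambaraIdeal.le_def, SetLike.not_le_iff_exists]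
  rw [this]
  exact isOpen_iUnion fun H => isOpen_iUnion fun x => isOpen_iUnion fun _ =>
    TopologicalSpace.isOpen_generateFrom_of_mem ⟨H, x, rfl⟩

/-- Sets of this form already make up a topology: intersections of opens correspond to `I ⊓ J`
because the points are prime, and unions to suprema of ideals. -/
theorem exists_zeroLocus_compl {U : Set (NakSpec T)} (hU : IsOpen U) :
    ∃ I : TambaraIdeal T, U = (zeroLocus I)ᶜ := by
  induction hU with
  | basic s hs =>
    obtain ⟨H, x, rfl⟩ := hs
    refine ⟨TambaraIdeal.principal x, ?_⟩
    ext P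
    simp [zeroLocus, TambaraIdeal.principal_le_iff]
  | univ =>
    refine ⟨⊤, ?_⟩
    ext P
    simpa [zeroLocus] using P.2.ne_top
  | inter s t _ _ hs ht =>
    obtain ⟨I, rfl⟩ := hs
    obtain ⟨J, rfl⟩ := ht
    refine ⟨I ⊓ J, ?_⟩
    ext P
    simp [zeroLocus, P.2.inf_le]
  | sUnion S _ hS =>
    choose! f hf using hS
    refine ⟨sSup (f '' S), ?_⟩
    ext P
    simp only [Set.mem_sUnion, zeroLocus, Set.mem_compl_iff, Set.mem_ofPred_eq, sSup_le_iff,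
      Set.forall_mem_image, not_forall]
    refine ⟨fun ⟨U, hU, hP⟩ => ⟨U, hU, ?_⟩, fun ⟨U, hU, hP⟩ => ⟨U, hU, ?_⟩⟩
    · rw [hf U hU] at hP
      exact hP
    · rw [hf U hU]
      exact hP

/-- The complements of the two zero loci cover by coprimality and are disjoint because every prime
contains `I` or `J`. A prime above `J` avoids `I`, and vice versa, so both are nonempty. -/
theorem not_preconnectedSpace_of_coprime {I J : TambaraIdeal T} (h : I.Coprime J)
    (hIJ : I ⊓ J ≤ nilradical T) (hI : I ≠ ⊤) (hJ : J ≠ ⊤) : ¬ PreconnectedSpace (NakSpec T) := by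
  rw [TambaraIdeal.coprime_iff] at h
  rw [TambaraIdeal.inf_le_nilradical_iff] at hIJ
  intro hc
  obtain ⟨P, hP, hIP⟩ := TambaraIdeal.exists_isPrime_of_ne_top hI
  obtain ⟨Q, hQ, hJQ⟩ := TambaraIdeal.exists_isPrime_of_ne_top hJ
  obtain ⟨M, -, hMI, hMJ⟩ := hc.isPreconnected_univ _ _ (isOpen_compl_zeroLocus I)
    (isOpen_compl_zeroLocus J)
    (fun M _ => not_and_or.1 (h M.1 M.2))
    ⟨⟨Q, hQ⟩, trivial, fun hIQ => h Q hQ ⟨hIQ, hJQ⟩⟩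
    ⟨⟨P, hP⟩, trivial, fun hJP => h P hP ⟨hIP, hJP⟩⟩
  exact (hIJ M.1 M.2).elim hMI hMJ

theorem exists_coprime_of_not_preconnectedSpace (h : ¬ PreconnectedSpace (NakSpec T)) :
    ∃ I J : TambaraIdeal T, I.Coprime J ∧ I ⊓ J ≤ nilradical T ∧ I ≠ ⊤ ∧ J ≠ ⊤ := by
  have : ¬ IsPreconnected (Set.univ : Set (NakSpec T)) := fun h' => h ⟨h'⟩
  simp only [IsPreconnected, not_forall] at this
  obtain ⟨U, V, hU, hV, hUV, ⟨P, -, hP⟩, ⟨Q, -, hQ⟩, hne⟩ := this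
  rw [Set.univ_inter, Set.not_nonempty_iff_eq_empty] at hne
  obtain ⟨I, rfl⟩ := exists_zeroLocus_compl hU
  obtain ⟨J, rfl⟩ := exists_zeroLocus_compl hV
  have h₁ : ∀ M : NakSpec T, I ≤ M.1 ∨ J ≤ M.1 := fun M => by
    by_contra hM
    rw [not_or] at hM
    exact (hne ▸ hM : M ∈ (∅ : Set (NakSpec T)))
  refine ⟨I, J, TambaraIdeal.coprime_iff.2 fun M hM => not_and_or.2 (hUV (Set.mem_univ ⟨M, hM⟩)),
    TambaraIdeal.inf_le_nilradical_iff.2 fun M hM => h₁ ⟨M, hM⟩, ?_, ?_⟩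
  · rintro rfl
    exact Q.2.ne_top (top_le_iff.1 ((h₁ Q).resolve_right hQ))
  · rintro rfl
    exact P.2.ne_top (top_le_iff.1 ((h₁ P).resolve_left hP))

end NakSpec

/-! ### Complements in the lattice of radical ideals -/

namespace RadId

variable {T : TambaraFunctor.{u, v} G}

theorem coe_bot : (⊥ : RadId T).1 = nilradical T :=
  le_antisymm ((bot_le : (⊥ : RadId T) ≤ ⟨nilradical T, TambaraIdeal.isRadical_radical ⊥⟩))
    ((⊥ : RadId T).2.radical_le_iff.2 bot_le)

theorem coe_top : (⊤ : RadId T).1 = ⊤ := by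
  have h : ∀ A : RadId T, A ≤ ⊤ := fun _ => le_top
  exact top_le_iff.1 (h ⟨⊤, le_antisymm (TambaraIdeal.le_radical _) le_top⟩)

/-- The join in `RadId T` is not the levelwise sum by definition. Primes bridge the gap: they are
radical, so a prime containing both ideals is an upper bound in `RadId T`. -/
theorem coprime_of_codisjoint {I J : RadId T} (h : Codisjoint I J) : I.1.Coprime J.1 :=
  TambaraIdeal.coprime_iff.2 fun P hP hle => hP.ne_top (top_le_iff.1 (by
    rw [← coe_top]
    exact h (x := ⟨P, hP.isRadical⟩) hle.1 hle.2))

theorem codisjoint_of_coprime {I J : RadId T} (h : I.1.Coprime J.1) : Codisjoint I J := by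
  intro K hI hJ
  change (⊤ : RadId T).1 ≤ K.1
  rw [coe_top, ← h]
  exact sup_le hI hJ

theorem isRadical_inf {I J : TambaraIdeal T} (hI : I.IsRadical) (hJ : J.IsRadical) :
    (I ⊓ J).IsRadical :=
  le_antisymm (TambaraIdeal.le_radical _) (le_inf (hI.radical_le_iff.2 inf_le_left)
    (hJ.radical_le_iff.2 inf_le_right))

theorem disjoint_iff_inf_le {I J : RadId T} : Disjoint I J ↔ I.1 ⊓ J.1 ≤ nilradical T := by
  rw [← coe_bot]
  exact ⟨fun h => h (x := ⟨I.1 ⊓ J.1, isRadical_inf I.2 J.2⟩)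
      (inf_le_left : I.1 ⊓ J.1 ≤ I.1) (inf_le_right : I.1 ⊓ J.1 ≤ J.1),
    fun h K hI hJ =>
      ((le_inf (show K.1 ≤ I.1 from hI) (show K.1 ≤ J.1 from hJ)).trans h : K.1 ≤ _)⟩

/-- The radicals of `I` and `J` have the same primes above them as `I` and `J`, so they are
complementary. If `√I` were `√0`, a prime above `J` would contain `I` as well. -/
theorem exists_isComplemented_of_coprime {I J : TambaraIdeal T} (h : I.Coprime J)
    (hIJ : I ⊓ J ≤ nilradical T) (hI : I ≠ ⊤) (hJ : J ≠ ⊤) :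
    ∃ I : RadId T, IsComplemented I ∧ I ≠ ⊥ ∧ I ≠ ⊤ := by
  obtain ⟨P, hP, hIP⟩ := TambaraIdeal.exists_isPrime_of_ne_top hI
  obtain ⟨Q, hQ, hJQ⟩ := TambaraIdeal.exists_isPrime_of_ne_top hJ
  refine ⟨⟨_, TambaraIdeal.isRadical_radical I⟩, ⟨⟨_, TambaraIdeal.isRadical_radical J⟩,
    disjoint_iff_inf_le.2 ?_, codisjoint_of_coprime ?_⟩, ?_, ?_⟩
  · rw [TambaraIdeal.inf_le_nilradical_iff] at hIJ ⊢
    exact fun M hM => (hIJ M hM).imp hM.isRadical.radical_le_iff.2 hM.isRadical.radical_le_iff.2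
  · exact top_le_iff.1 (h.ge.trans (sup_le_sup (TambaraIdeal.le_radical I)
      (TambaraIdeal.le_radical J)))
  · intro e
    have e' : TambaraIdeal.radical I = nilradical T := (congrArg Subtype.val e).trans coe_bot
    exact TambaraIdeal.coprime_iff.1 h Q hQ ⟨(TambaraIdeal.le_radical I).trans
      (e'.le.trans (TambaraIdeal.nilradical_le_prime hQ)), hJQ⟩
  · intro e
    have e' : TambaraIdeal.radical I = ⊤ := (congrArg Subtype.val e).trans coe_top
    exact hP.ne_top (top_le_iff.1 (e'.ge.trans (hP.isRadical.radical_le_iff.2 hIP)))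

end RadId

/-! ### Ideals of a quotient and passage to the reduction -/

namespace TambaraIdeal

variable {T : TambaraFunctor.{u, v} G} (N : TambaraIdeal T)

/-- The preimage in `T` of a Tambara ideal of `T / N`. -/
def comapProj (J : TambaraIdeal N.quotient) : TambaraIdeal T where
  lvl H := (J.lvl H).comap (N.proj H)
  res_mem h _ hx := J.res_mem h hx
  tr_mem h _ hx := J.tr_mem h hx
  nm_mem h _ hx := J.nm_mem h hx
  c_mem g _ _ e _ hx := J.c_mem g e hx

/-- The image in `T / N` of a Tambara ideal of `T`. -/
def mapProj (I : TambaraIdeal T) : TambaraIdeal N.quotient where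
  lvl H := (I.lvl H).map (N.proj H)
  res_mem {K H} h y hy := by
    obtain ⟨x, hx, rfl⟩ := (Ideal.mem_map_iff_of_surjective _ (N.proj_surjective H)).1 hy
    exact Ideal.mem_map_of_mem (N.proj K) (I.res_mem h hx)
  tr_mem {K H} h y hy := by
    obtain ⟨x, hx, rfl⟩ := (Ideal.mem_map_iff_of_surjective _ (N.proj_surjective K)).1 hy
    exact Ideal.mem_map_of_mem (N.proj H) (I.tr_mem h hx)
  nm_mem {K H} h y hy := by
    obtain ⟨x, hx, rfl⟩ := (Ideal.mem_map_iff_of_surjective _ (N.proj_surjective K)).1 hy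
    exact Ideal.mem_map_of_mem (N.proj H) (I.nm_mem h hx)
  c_mem g H K e y hy := by
    obtain ⟨x, hx, rfl⟩ := (Ideal.mem_map_iff_of_surjective _ (N.proj_surjective H)).1 hy
    exact Ideal.mem_map_of_mem (N.proj K) (I.c_mem g e hx)

variable {N}

theorem mapProj_le_iff {I : TambaraIdeal T} {J : TambaraIdeal N.quotient} :
    N.mapProj I ≤ J ↔ I ≤ N.comapProj J :=
  forall_congr' fun _ => Ideal.map_le_iff_le_comap

theorem comapProj_mapProj {I : TambaraIdeal T} (h : N ≤ I) : N.comapProj (N.mapProj I) = I := by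
  refine le_antisymm (fun H => ?_) (mapProj_le_iff.1 le_rfl)
  change ((I.lvl H).map (N.proj H)).comap (N.proj H) ≤ I.lvl H
  rw [Ideal.comap_map_of_surjective _ (N.proj_surjective H)]
  refine sup_le le_rfl fun x hx => h H ?_
  exact Ideal.Quotient.eq_zero_iff_mem.1 hx

theorem power_le_comapProj_power {I : TambaraIdeal T} {J : TambaraIdeal N.quotient}
    (h : I ≤ N.comapProj J) : ∀ n, power I n ≤ N.comapProj (power J n)
  | 0 => fun _ _ _ => trivial
  | 1 => h
  | n + 2 => (mul_mono (power_le_comapProj_power h (n + 1)) h).trans (mul_le_iff.2 fun H =>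
      (Ideal.le_comap_mul (N.proj H)).trans (Ideal.comap_mono (mul_le_iff.1 le_rfl H)))

/-- The powers of `⟨x⟩` land in the preimages of the powers of `⟨N.proj H x⟩`, and the preimage of
the image of `I` is `I` because `N ≤ I`. -/
theorem IsRadical.mapProj {I : TambaraIdeal T} (hI : I.IsRadical) (h : N ≤ I) :
    (N.mapProj I).IsRadical := by
  refine le_antisymm (le_radical _) fun H y hy => ?_
  obtain ⟨x, rfl⟩ := N.proj_surjective H y
  obtain ⟨n, hn, hy⟩ := hy
  refine Ideal.mem_map_of_mem (N.proj H) ?_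
  rw [hI]
  refine ⟨n, hn, (power_le_comapProj_power (principal_le_iff.2 ?_) n).trans
    (b := N.comapProj (power (principal (T := N.quotient) (N.proj H x)) n)) ?_⟩
  · exact mem_principal (T := N.quotient) (N.proj H x)
  · refine le_trans (fun H => Ideal.comap_mono (hy H)) (comapProj_mapProj h).le

end TambaraIdeal

theorem exists_coprime_reduction {T : TambaraFunctor.{u, v} G} {I : RadId T}
    (hc : IsComplemented I) (hbot : I ≠ ⊥) (htop : I ≠ ⊤) :
    ∃ I J : TambaraIdeal (reduction T),
      I.IsRadical ∧ J.IsRadical ∧ I.Coprime J ∧ I ⊓ J = ⊥ ∧ I ≠ ⊥ ∧ J ≠ ⊥ := by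
  obtain ⟨J, hd, hcd⟩ := hc
  have hle : ∀ A : RadId T, nilradical T ≤ A.1 := fun A => by
    rw [← RadId.coe_bot]
    exact bot_le (a := A)
  have hne : ∀ A : RadId T, A ≠ ⊥ → (nilradical T).mapProj A.1 ≠ ⊥ := fun A hA h => by
    refine hA (Subtype.ext (le_antisymm ?_ (bot_le (a := A))))
    rw [RadId.coe_bot]
    intro H x hx
    have : (nilradical T).proj H x ∈ ((nilradical T).mapProj A.1).lvl H :=
      Ideal.mem_map_of_mem _ hx
    rw [h] at this
    exact Ideal.Quotient.eq_zero_iff_mem.1 this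
  refine ⟨(nilradical T).mapProj I.1, (nilradical T).mapProj J.1, I.2.mapProj (hle I),
    J.2.mapProj (hle J), top_le_iff.1 fun H y _ => ?_, le_bot_iff.1 fun H y hy => ?_,
    hne I hbot, hne J fun h => ?_⟩
  · obtain ⟨x, rfl⟩ := (nilradical T).proj_surjective H y
    have hx : x ∈ (I.1 ⊔ J.1).lvl H := (RadId.coprime_of_codisjoint hcd).ge H trivial
    obtain ⟨a, ha, b, hb, rfl⟩ := Submodule.mem_sup.1 hx
    rw [map_add]
    exact Submodule.add_mem_sup (Ideal.mem_map_of_mem _ ha) (Ideal.mem_map_of_mem _ hb)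
  · obtain ⟨x, rfl⟩ := (nilradical T).proj_surjective H y
    refine Ideal.Quotient.eq_zero_iff_mem.2 (RadId.disjoint_iff_inf_le.1 hd H ⟨?_, ?_⟩)
    · rw [← TambaraIdeal.comapProj_mapProj (hle I)]
      exact hy.1
    · rw [← TambaraIdeal.comapProj_mapProj (hle J)]
      exact hy.2
  · rw [h] at hcd
    exact htop (codisjoint_bot.1 hcd)

/-! ### The Chinese remainder theorem -/

namespace TambaraIdeal

variable {T : TambaraFunctor.{u, v} G}

theorem isNontrivial_quotient {I : TambaraIdeal T} (h : I ≠ ⊤) : I.quotient.IsNontrivial := by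
  by_contra h'
  refine h (top_le_iff.1 fun H x _ => Ideal.Quotient.eq_zero_iff_mem.1 ?_)
  have : ¬ Nontrivial (I.quotient.obj H) := fun hH => h' ⟨H, hH⟩
  rw [not_nontrivial_iff_subsingleton] at this
  exact this.elim (I.proj H x) 0

theorem bijective_proj_prod {I J : TambaraIdeal T} (h : I.Coprime J) (h' : I ⊓ J = ⊥)
    (H : Subgroup G) : Function.Bijective ((I.proj H).prod (J.proj H)) := by
  constructor
  · rw [injective_iff_map_eq_zero]
    intro x hx
    exact h'.le H ⟨Ideal.Quotient.eq_zero_iff_mem.1 (congrArg Prod.fst hx),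
      Ideal.Quotient.eq_zero_iff_mem.1 (congrArg Prod.snd hx)⟩
  · rintro ⟨x, y⟩
    obtain ⟨x, rfl⟩ := I.proj_surjective H x
    obtain ⟨y, rfl⟩ := J.proj_surjective H y
    have hxy : x - y ∈ (I ⊔ J).lvl H := h.ge H trivial
    obtain ⟨a, ha, b, hb, hab⟩ := Submodule.mem_sup.1 hxy
    -- Writing `x - y = a + b` with `a` in `I` and `b` in `J`, the element `x - a = y + b` is
    -- congruent to `x` modulo `I` and to `y` modulo `J`.
    refine ⟨x - a, Prod.ext ((Ideal.Quotient.mk_eq_mk_iff_sub_mem _ _).2 ?_)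
      ((Ideal.Quotient.mk_eq_mk_iff_sub_mem _ _).2 ?_)⟩
    · rw [sub_sub_cancel_left]
      exact Submodule.neg_mem _ ha
    · have : x - a - y = b := by linear_combination -hab
      rwa [this]

/-- The Chinese remainder theorem: `T ≅ T / I × T / J` for coprime `I` and `J` that intersect
in zero. -/
noncomputable def prodQuotientIso {I J : TambaraIdeal T} (h : I.Coprime J) (h' : I ⊓ J = ⊥) :
    TambaraIso T (I.quotient.prod J.quotient) where
  toEquiv H := RingEquiv.ofBijective _ (bijective_proj_prod h h' H)
  map_res _ _ := rfl
  map_tr _ _ := rfl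
  map_nm _ _ := rfl
  map_c _ _ _ _ _ := rfl

theorem exists_prod_iso {I J : TambaraIdeal T} (h : I.Coprime J) (h' : I ⊓ J = ⊥) (hI : I ≠ ⊥)
    (hJ : J ≠ ⊥) : ∃ T₁ T₂ : TambaraFunctor.{u, v} G, T₁.IsNontrivial ∧ T₂.IsNontrivial ∧
      Nonempty (TambaraIso T (T₁.prod T₂)) := by
  refine ⟨I.quotient, J.quotient, isNontrivial_quotient ?_, isNontrivial_quotient ?_,
    ⟨prodQuotientIso h h'⟩⟩
  · rintro rfl
    exact hJ (by rwa [top_inf_eq] at h')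
  · rintro rfl
    exact hI (by rwa [inf_top_eq] at h')

end TambaraIdeal

/-! ### Kernels of the projections of a product decomposition -/

namespace TambaraIso

variable {S T₁ T₂ : TambaraFunctor.{u, v} G}

/-- The preimage in `S` of `0 × T₂` under `S ≅ T₁ × T₂`. -/
def kerFst (φ : TambaraIso S (T₁.prod T₂)) : TambaraIdeal S where
  lvl H := RingHom.ker ((T₁.fst T₂.toPreTambara H).comp
    (φ.toEquiv H : S.obj H →+* (T₁.prod T₂).obj H))
  res_mem {K H} h x hx := by
    change T₁.fst T₂.toPreTambara K (φ.toEquiv K (S.res h x)) = 0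
    rw [φ.map_res]
    exact (congrArg (T₁.res h) hx).trans (map_zero _)
  tr_mem {K H} h x hx := by
    change T₁.fst T₂.toPreTambara H (φ.toEquiv H (S.tr h x)) = 0
    rw [φ.map_tr]
    exact (congrArg (T₁.tr h) hx).trans (map_zero _)
  nm_mem {K H} h x hx := by
    change T₁.fst T₂.toPreTambara H (φ.toEquiv H (S.nm h x)) = 0
    rw [φ.map_nm]
    exact (congrArg (T₁.nm h) hx).trans (T₁.nm_zero h)
  c_mem g H K e x hx := by
    change T₁.fst T₂.toPreTambara K (φ.toEquiv K (S.c g e x)) = 0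
    rw [φ.map_c]
    exact (congrArg (T₁.c g e) hx).trans (map_zero _)

/-- Exchanging the two factors of a product decomposition. -/
def swap (φ : TambaraIso S (T₁.prod T₂)) : TambaraIso S (T₂.prod T₁) where
  toEquiv H := (φ.toEquiv H).trans (RingEquiv.prodComm (R := T₁.obj H) (S := T₂.obj H))
  map_res h x := congrArg Prod.swap (φ.map_res h x)
  map_tr h x := congrArg Prod.swap (φ.map_tr h x)
  map_nm h x := congrArg Prod.swap (φ.map_nm h x)
  map_c g _ _ e x := congrArg Prod.swap (φ.map_c g e x)

theorem kerFst_ne_top (φ : TambaraIso S (T₁.prod T₂)) (h : T₁.IsNontrivial) : φ.kerFst ≠ ⊤ := by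
  intro e
  obtain ⟨H, hH⟩ := h
  obtain ⟨x, hx⟩ := (φ.toEquiv H).surjective ((1, 0) : T₁.obj H × T₂.obj H)
  have : (φ.toEquiv H x).1 = 0 := e.ge H (trivial : x ∈ (⊤ : TambaraIdeal S).lvl H)
  rw [hx] at this
  exact one_ne_zero this

theorem kerFst_coprime (φ : TambaraIso S (T₁.prod T₂)) : φ.kerFst.Coprime φ.swap.kerFst := by
  refine top_le_iff.1 fun H z _ => ?_
  -- `y` corresponds to the first component of `z`, so it lies in the kernel of the second
  -- projection and `z - y` in that of the first.
  obtain ⟨y, hy⟩ := (φ.toEquiv H).surjective (((φ.toEquiv H z).1, 0) : T₁.obj H × T₂.obj H)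
  rw [← sub_add_cancel z y]
  refine Submodule.add_mem_sup ?_ ?_
  · change (φ.toEquiv H (z - y)).1 = 0
    rw [map_sub, hy]
    exact sub_self _
  · change (φ.toEquiv H y).2 = 0
    rw [hy]

theorem kerFst_inf (φ : TambaraIso S (T₁.prod T₂)) : φ.kerFst ⊓ φ.swap.kerFst = ⊥ :=
  le_bot_iff.1 fun H x hx => by
    have : φ.toEquiv H x = 0 := Prod.ext hx.1 hx.2
    rwa [map_eq_zero_iff _ (φ.toEquiv H).injective] at this

end TambaraIso

/-! ### Pulling a coprime pair back along the quotient map -/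

namespace TambaraIdeal

variable {T : TambaraFunctor.{u, v} G} {N : TambaraIdeal T}

theorem Coprime.comapProj {I J : TambaraIdeal N.quotient} (h : I.Coprime J) :
    (N.comapProj I).Coprime (N.comapProj J) := by
  refine top_le_iff.1 fun H z _ => ?_
  obtain ⟨a, ha, b, hb, hab⟩ := Submodule.mem_sup.1
    (h.ge H trivial : (N.proj H z : N.quotient.obj H) ∈ I.lvl H ⊔ J.lvl H)
  obtain ⟨a, rfl⟩ := N.proj_surjective H a
  rw [← add_sub_cancel a z]
  refine Submodule.add_mem_sup ha ?_
  change N.proj H (z - a) ∈ J.lvl H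
  rw [map_sub]
  exact (sub_eq_of_eq_add' hab.symm : N.proj H z - N.proj H a = b) ▸ hb

theorem comapProj_inf_le {I J : TambaraIdeal N.quotient} (h : I ⊓ J = ⊥) :
    N.comapProj I ⊓ N.comapProj J ≤ N := fun H _ hx =>
  Ideal.Quotient.eq_zero_iff_mem.1 (h.le H hx)

theorem comapProj_ne_top {I : TambaraIdeal N.quotient} (h : I ≠ ⊤) : N.comapProj I ≠ ⊤ := by
  refine fun e => h (top_le_iff.1 fun H y _ => ?_)
  obtain ⟨x, rfl⟩ := N.proj_surjective H y
  exact e.ge H (trivial : x ∈ (⊤ : TambaraIdeal T).lvl H)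

end TambaraIdeal

end Tamb

/-! ### The cycle of implications -/

theorem mainTheorem11 {G : Type v} [Group G] [Finite G] (T : Tamb.TambaraFunctor.{u, v} G) :
    List.TFAE [
      ¬ PreconnectedSpace (Tamb.NakSpec T),
      ∃ I : Tamb.RadId T, IsComplemented I ∧ I ≠ ⊥ ∧ I ≠ ⊤,
      ∃ I J : Tamb.TambaraIdeal (Tamb.reduction T),
        I.IsRadical ∧ J.IsRadical ∧ I.Coprime J ∧ I ⊓ J = ⊥ ∧ I ≠ ⊥ ∧ J ≠ ⊥,
      ∃ T₁ T₂ : Tamb.TambaraFunctor.{u, v} G,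
        T₁.IsNontrivial ∧ T₂.IsNontrivial ∧
          Nonempty (Tamb.TambaraIso (Tamb.reduction T) (T₁.prod T₂))] := by

  tfae_have 1 → 2 := fun h => by
    obtain ⟨I, J, h, hIJ, hI, hJ⟩ := Tamb.NakSpec.exists_coprime_of_not_preconnectedSpace h
    exact Tamb.RadId.exists_isComplemented_of_coprime h hIJ hI hJ
  tfae_have 2 → 3 := fun ⟨_, hc, hbot, htop⟩ => Tamb.exists_coprime_reduction hc hbot htop
  tfae_have 3 → 4 := fun ⟨_, _, _, _, h, h', hI, hJ⟩ =>
    Tamb.TambaraIdeal.exists_prod_iso h h' hI hJ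
  -- The pulled-back kernels meet inside `√0` rather than in zero, which is all that the
  -- disconnection of the spectrum of `T` needs; the spectrum of `T_red` does not enter.
  tfae_have 4 → 1 := fun ⟨_, _, h₁, h₂, ⟨φ⟩⟩ =>
    Tamb.NakSpec.not_preconnectedSpace_of_coprime φ.kerFst_coprime.comapProj
      (Tamb.TambaraIdeal.comapProj_inf_le φ.kerFst_inf)
      (Tamb.TambaraIdeal.comapProj_ne_top (φ.kerFst_ne_top h₁))
      (Tamb.TambaraIdeal.comapProj_ne_top (φ.swap.kerFst_ne_top h₂))
  tfae_finish
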